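/- Let $Q=[0,1]^{\mathbb N}$ be the Hilbert cube. For a compact metrizable space $X$ let $\mathcal K(X)$ be the space of nonempty compact subsets of $X$ with the Vietoris topology. A cantoroid is a nonempty compact metrizable space without isolated points in which the set of points whose connected component is a singleton is dense. A cantoroid is tame if its nondegenerate components form a null sequence, i.e. for every $\varepsilon>0$ only finitely many components have diameter at least $\varepsilon$. A homeomorphism $h:C\to C$ is minimal if $\{h^k(x):k\ge 0\}$ is dense in $C$ for every $x\in C$. Let $\mathcal M$ be the set of all pairs $(C,h)$, where $C\subseteq Q$ is a tame cantoroid not homeomorphic to the Cantor space and $h:C\to C$ is a minimal homeomorphism; identifying $h$ with its graph, regard $\mathcal M$ as a subset of the Polish space $\mathcal K(Q)\times\mathcal K(Q\times Q)$. Let $(C,h)$ and $(C',h')$ be conjugate if $\varphi\circ h=h'\circ\varphi$ for some homeomorphism $\varphi:C\to C'$. Let $E_{tt}(Q)$ be the equivalence relation on $Q^{\mathbb N}$ in which $(a_k)_k$ and $(a'_k)_k$ are equivalent iff for all $k_0<k_1<\cdots$ the subsequence $(a_{k_i})_i$ converges exactly when $(a'_{k_i})_i$ converges. For an equivalence relation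 $E$ on $Y$ let $E^+$ be the equivalence relation on $Y^{\mathbb N}$ in which $(y_n)_n$ and $(y'_n)_n$ are equivalent iff every $y_n$ is $E$-equivalent to some $y'_m$ and every $y'_m$ is $E$-equivalent to some $y_n$. Theorem. The set $\mathcal M$ is Borel, and the conjugacy relation on $\mathcal M$ is Borel reducible to $E_{tt}(Q)^+$: there is a Borel map $f:\mathcal M\to (Q^{\mathbb N})^{\mathbb N}$ such that $(C,h)$ and $(C',h')$ are conjugate if and only if $f(C,h)$ and $f(C',h')$ are $E_{tt}(Q)^+$-equivalent. Moreover, $f$ can be chosen of the form $f(C,h)=\bigl((h^k(x_n))_{k\in\mathbb N}\bigr)_{n\in\mathbb N}$, where each $x_n=x_n(C,h)$ lies in a nondegenerate component of $C$ and the set $\{x_n:n\in\mathbb N\}$ contains exactly one point of each nondegenerate component of $C$. Consequently, the conjugacy relation is a Borel subset of $\mathcal M\times\mathcal M$. -/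

import Mathlib

open Set Filter Topology Uniformity TopologicalSpace

/-- The hyperspace of nonempty compact subsets, with the Vietoris topology (the instance of Mathlib),
is equipped with its Borel sets. -/
instance nonemptyCompactsMeasurableSpace (X : Type*) [TopologicalSpace X] :
    MeasurableSpace (NonemptyCompacts X) := borel _

instance nonemptyCompactsBorelSpace (X : Type*) [TopologicalSpace X] :
    BorelSpace (NonemptyCompacts X) := ⟨rfl⟩

/-- The Hilbert cube `Q`, a countable infinite power of `[0, 1]` with the product topology. -/
abbrev HilbertCube : Type := ℕ → unitInterval

/-- A Cantor space: a nonempty compact (metrizable) zero-dimensional space without isolated points.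
This property is invariant under homeomorphisms. -/
structure IsCantorSpace (X : Type*) [TopologicalSpace X] : Prop where
  nonempty : Nonempty X
  compact : CompactSpace X
  metrizable : MetrizableSpace X
  zeroDimensional : IsTopologicalBasis {s : Set X | IsClopen s}
  noIsolated : ∀ x : X, ¬ IsOpen ({x} : Set X)

/-- A cantoroid: a nonempty compact (metrizable) space without isolated points in which the
(union of the) degenerate components is dense. -/
structure IsCantoroid (X : Type*) [TopologicalSpace X] : Prop where
  nonempty : Nonempty X
  compact : CompactSpace X
  metrizable : MetrizableSpace X
  dense_degenerate : Dense {x : X | connectedComponent x = {x}}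
  noIsolated : ∀ x : X, ¬ IsOpen ({x} : Set X)

/-- A tame cantoroid: the nondegenerate components form a null sequence, i.e. for every entourage
`V` all but finitely many components are `V`-small. For a metric inducing the uniformity this says
that for every `ε > 0` only finitely many components have diameter at least `ε`. A compact
Hausdorff space carries only one compatible uniformity, so this is a topological property. -/
structure IsTameCantoroid (X : Type*) [UniformSpace X] : Prop extends IsCantoroid X where
  null : ∀ V ∈ 𝓤 X,
    {K : Set X | (∃ x : X, K = connectedComponent x) ∧ ¬ K ×ˢ K ⊆ V}.Finite

/-- A map is minimal if every point has a dense (forward) orbit. -/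
def IsMinimalMap {X : Type*} [TopologicalSpace X] (h : X → X) : Prop :=
  ∀ x : X, Dense (Set.range fun k : ℕ => h^[k] x)

/-- The Polish space `K(Q) × K(Q × Q)` in which a pair `(C, h)` of a nonempty compact set `C ⊆ Q`
and a homeomorphism `h : C → C` is represented as `(C, graph of h)`. -/
abbrev SystemCode : Type :=
  NonemptyCompacts HilbertCube × NonemptyCompacts (HilbertCube × HilbertCube)

/-- The underlying space of a code, a subspace of the Hilbert cube. -/
abbrev SystemCode.space (p : SystemCode) : Type := {x : HilbertCube // x ∈ p.1}

/-- The second entry of `p` is the graph of the homeomorphism `h` of the space of `p`. -/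
def SystemCode.Codes (p : SystemCode) (h : p.space ≃ₜ p.space) : Prop :=
  (p.2 : Set (HilbertCube × HilbertCube)) =
    Set.range fun x : p.space => ((x : HilbertCube), (h x : HilbertCube))

/-- The set of all `(C, h)`, where `C ⊆ Q` is a tame cantoroid which is not a Cantor space
and `h : C → C` is a minimal homeomorphism. -/
def minimalTameSystems : Set SystemCode :=
  {p | IsTameCantoroid p.space ∧ ¬ IsCantorSpace p.space ∧
    ∃ h : p.space ≃ₜ p.space, p.Codes h ∧ IsMinimalMap h}

/-- Conjugacy of coded systems: `φ ∘ h = h' ∘ φ` for some homeomorphism `φ : C → C'`. -/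
def SystemCode.Conjugate (p q : SystemCode) : Prop :=
  ∃ (h : p.space ≃ₜ p.space) (h' : q.space ≃ₜ q.space), p.Codes h ∧ q.Codes h' ∧
    ∃ φ : p.space ≃ₜ q.space, ∀ x, φ (h x) = h' (φ x)

theorem SystemCode.Codes.unique {p : SystemCode} {h h' : p.space ≃ₜ p.space}
    (H : p.Codes h) (H' : p.Codes h') : h = h' := by
  ext1 x
  have hx : ((x : HilbertCube), (h x : HilbertCube)) ∈
      Set.range fun x : p.space => ((x : HilbertCube), (h' x : HilbertCube)) := by
    rw [← H', H]
    exact ⟨x, rfl⟩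
  obtain ⟨y, hy⟩ := hx
  obtain ⟨h1, h2⟩ := Prod.mk.inj hy
  obtain rfl : y = x := Subtype.ext h1
  exact (Subtype.ext h2).symm

/-- The conjugacy relation of minimal homeomorphisms on tame cantoroids other than the
Cantor space. -/
def conjugacySetoid : Setoid minimalTameSystems where
  r p q := SystemCode.Conjugate p q
  iseqv :=
    { refl := fun p => by
        obtain ⟨h, hc, -⟩ := p.2.2.2
        exact ⟨h, h, hc, hc, Homeomorph.refl _, fun _ => rfl⟩
      symm := by
        rintro p q ⟨h, h', hc, hc', φ, hφ⟩
        refine ⟨h', h, hc', hc, φ.symm, fun y => ?_⟩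
        apply φ.injective
        rw [hφ, φ.apply_symm_apply, φ.apply_symm_apply]
      trans := by
        rintro p q r ⟨h, h', hc, hc', φ, hφ⟩ ⟨k, k', kc, kc', ψ, hψ⟩
        obtain rfl := hc'.unique kc
        refine ⟨h, k', hc, kc', φ.trans ψ, fun x => ?_⟩
        simp only [Homeomorph.trans_apply, hφ, hψ] }

/-- The relation `E_tt(X)` on `X^ℕ`: the same subsequences of the two sequences converge. -/
def ettSetoid (X : Type*) [TopologicalSpace X] : Setoid (ℕ → X) where
  r a b := ∀ n : ℕ → ℕ, StrictMono n →
    ((∃ l, Tendsto (fun k => a (n k)) atTop (𝓝 l)) ↔ ∃ l, Tendsto (fun k => b (n k)) atTop (𝓝 l))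
  iseqv :=
    { refl := fun _ _ _ => Iff.rfl
      symm := fun h n hn => (h n hn).symm
      trans := fun h h' n hn => (h n hn).trans (h' n hn) }

/-- The relation `E⁺` on `X^ℕ`: the two sequences meet the same `E`-classes. -/
def plusSetoid {X : Type*} (E : Setoid X) : Setoid (ℕ → X) where
  r a b := (∀ n, ∃ m, E.r (a n) (b m)) ∧ ∀ m, ∃ n, E.r (a n) (b m)
  iseqv :=
    { refl := fun _ => ⟨fun n => ⟨n, E.iseqv.refl _⟩, fun n => ⟨n, E.iseqv.refl _⟩⟩
      symm := fun h => ⟨fun n => (h.2 n).imp fun _ => E.iseqv.symm,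
        fun m => (h.1 m).imp fun _ => E.iseqv.symm⟩
      trans := fun h h' =>
        ⟨fun n => let ⟨m, hm⟩ := h.1 n; let ⟨l, hl⟩ := h'.1 m; ⟨l, E.iseqv.trans hm hl⟩,
          fun l => let ⟨m, hm⟩ := h'.2 l; let ⟨n, hn⟩ := h.2 m; ⟨n, E.iseqv.trans hn hm⟩⟩ }

/-- `f` is a Borel measurable reduction from `E` to `F`. -/
structure IsBorelReduction {X Y : Type*} [MeasurableSpace X] [MeasurableSpace Y]
    (E : Setoid X) (F : Setoid Y) (f : X → Y) : Prop where
  measurable : Measurable f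
  reduction : ∀ x x' : X, E.r x x' ↔ F.r (f x) (f x')

/-!
A minimal homeomorphism `h` of a tame cantoroid `C` permutes the components of `C`. No nondegenerate
component is periodic, because finitely many nondegenerate components cannot cover `C`; hence the
iterates of a nondegenerate component are pairwise distinct and, by tameness, they shrink
(`IsTameCantoroid.tendsto_uniformity_iterate`). So the forward orbits of two points of the same
nondegenerate component are asymptotic, and the class of `(h^k x)_k` under `E_tt` depends only on
the component of `x`. A conjugacy therefore matches the classes attached to the nondegenerate
components of the two systems. Conversely, a single pair of `E_tt`-equivalent orbits suffices for
conjugacy: the orbits are dense, and the cluster points of the sequence of pairs `(h^k x, g^k y)`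
form a closed relation, which `E_tt`-equivalence makes the graph of a homeomorphism
(`IsMinimalMap.exists_conjugacy`).

All Borel computations rest on one principle (`measurableSet_setOf_exists`): the projection along a
compact factor of the intersection of a closed and an open set is `F_σ`. It is applied to the
relation "`x` and `y` lie in the same component of `C`", which is closed in `(C, x, y)`
(`isClosed_setOf_mem_connectedComponentIn`). With the Baire category theorem for the density of the
degenerate components, this shows that the set of systems is Borel. For the selection of points, a
nondegenerate component `K` is singled out by an entourage `V` and a basic open set `U` such that
`K` is the only component which is not `V`-small and meets the closure of `U`. For given `V` and `U`
the set of all `C` in which they single out a component is Borel, and this component is a section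
of a closed set. One point of it is chosen by a Borel choice function on closed sets, the least
point for a parametrization by the Cantor set (`measurable_leastPoint`). As the choice depends on
the component only, different pairs `(V, U)` never select different points of one component.

Finally `E_tt` is Borel since, by compactness, two sequences are equivalent if and only if closeness
of late terms of either one entails closeness of the corresponding terms of the other
(`convergesAlong_iff_tendsto`).
-/

/-! ### Projections along a compact factor -/

section Projection

variable {Y K : Type*} [TopologicalSpace Y] [TopologicalSpace K] [CompactSpace K]

theorem isClosed_setOf_exists {A : Y → K → Prop} (hA : IsClosed {z : Y × K | A z.1 z.2}) :
    IsClosed {y | ∃ k, A y k} := by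
  have : {y | ∃ k, A y k} = Prod.fst '' {z : Y × K | A z.1 z.2} := by
    ext y; simp
  rw [this]
  exact isClosedMap_fst_of_compactSpace _ hA

theorem isOpen_setOf_forall {A : Y → K → Prop} (hA : IsOpen {z : Y × K | A z.1 z.2}) :
    IsOpen {y | ∀ k, A y k} := by
  have h := (isClosed_setOf_exists (A := fun y k => ¬ A y k) hA.isClosed_compl).isOpen_compl
  simpa [Set.compl_def] using h

/-- The projection along a compact factor of the intersection of a closed and an open set is an
`F_σ` set, hence Borel. -/
theorem measurableSet_setOf_exists [PseudoMetrizableSpace Y] [PseudoMetrizableSpace K]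
    [MeasurableSpace Y] [BorelSpace Y] {A B : Y → K → Prop}
    (hA : IsClosed {z : Y × K | A z.1 z.2}) (hB : IsOpen {z : Y × K | B z.1 z.2}) :
    MeasurableSet {y | ∃ k, A y k ∧ B y k} := by
  let _ := pseudoMetrizableSpacePseudoMetric (Y × K)
  obtain ⟨F, hF, -, hU, -⟩ := hB.exists_iUnion_isClosed
  have hBF (y : Y) (k : K) : B y k ↔ ∃ n, (y, k) ∈ F n := by
    rw [← mem_iUnion, hU]; rfl
  have : {y | ∃ k, A y k ∧ B y k} = ⋃ n, {y | ∃ k, A y k ∧ (y, k) ∈ F n} := by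
    ext y
    simp only [mem_ofPred_eq, mem_iUnion, hBF]
    exact ⟨fun ⟨k, h, n, hn⟩ => ⟨n, k, h, hn⟩, fun ⟨n, k, h, hn⟩ => ⟨k, h, n, hn⟩⟩
  rw [this]
  exact MeasurableSet.iUnion fun n => (isClosed_setOf_exists
    (A := fun y k => A y k ∧ (y, k) ∈ F n) (hA.inter (hF n))).measurableSet

end Projection

/-! ### Borel selection of a point in a closed set -/

section Selector

variable (X : Type*) [TopologicalSpace X] [CompactSpace X] [MetrizableSpace X] [Nonempty X]

theorem exists_cantorSet_continuous_surjective :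
    ∃ π : cantorSet → X, Continuous π ∧ Function.Surjective π := by
  let _ := metrizableSpaceMetric X
  obtain ⟨f, hf, hs⟩ := exists_nat_bool_continuous_surjective_of_compact X
  exact ⟨f ∘ cantorSetHomeomorphNatToBool, hf.comp cantorSetHomeomorphNatToBool.continuous,
    hs.comp cantorSetHomeomorphNatToBool.surjective⟩

/-- A continuous parametrization of a compact metrizable space by the Cantor set in the line. -/
noncomputable def cantorParam : cantorSet → X :=
  (exists_cantorSet_continuous_surjective X).choose

theorem continuous_cantorParam : Continuous (cantorParam X) :=
  (exists_cantorSet_continuous_surjective X).choose_spec.1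

theorem surjective_cantorParam : Function.Surjective (cantorParam X) :=
  (exists_cantorSet_continuous_surjective X).choose_spec.2

instance : CompactSpace cantorSet := isCompact_iff_compactSpace.1 isCompact_cantorSet

variable {X}

/-- A choice function on the nonempty closed sets of a compact metrizable space: the image of the
least parameter in the Cantor set. The value at a set which is empty or not closed carries no
meaning. -/
noncomputable def leastPoint (A : Set X) : X :=
  open Classical in
  if h : sInf ((↑) '' (cantorParam X ⁻¹' A) : Set ℝ) ∈ cantorSet then cantorParam X ⟨_, h⟩
  else Classical.arbitrary X

theorem sInf_mem_of_isClosed {A : Set X} (hA : IsClosed A) (hne : A.Nonempty) :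
    sInf ((↑) '' (cantorParam X ⁻¹' A) : Set ℝ) ∈
      ((↑) '' (cantorParam X ⁻¹' A) : Set ℝ) := by
  have hc : IsCompact ((↑) '' (cantorParam X ⁻¹' A) : Set ℝ) :=
    (hA.preimage (continuous_cantorParam X)).isCompact.image continuous_subtype_val
  exact hc.sInf_mem ((hne.preimage (surjective_cantorParam X)).image _)

theorem leastPoint_mem {A : Set X} (hA : IsClosed A) (hne : A.Nonempty) : leastPoint A ∈ A := by
  obtain ⟨t, ht, h⟩ := sInf_mem_of_isClosed hA hne
  have hm : sInf ((↑) '' (cantorParam X ⁻¹' A) : Set ℝ) ∈ cantorSet := h ▸ t.2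
  rw [leastPoint, dif_pos hm]
  have : (⟨_, hm⟩ : cantorSet) = t := Subtype.ext h.symm
  rwa [this]

/-- The chosen point depends in a Borel way on the sections of a closed set. -/
theorem measurable_leastPoint [MeasurableSpace X] [BorelSpace X] {Y : Type*} [TopologicalSpace Y]
    [MeasurableSpace Y] [BorelSpace Y] {A : Y → X → Prop}
    (hA : IsClosed {z : Y × X | A z.1 z.2}) :
    Measurable fun y => leastPoint {x | A y x} := by
  have hcl (y : Y) : IsClosed {x | A y x} := hA.preimage (Continuous.prodMk_right y)
  have hm : Measurable fun y : Y => sInf ((↑) '' (cantorParam X ⁻¹' {x | A y x}) : Set ℝ) := by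
    refine measurable_of_Iic fun a => ?_
    have h1 : IsClosed {y : Y | ∃ t : cantorSet, A y (cantorParam X t) ∧ (t : ℝ) ≤ a} := by
      refine isClosed_setOf_exists (A := fun y t => A y (cantorParam X t) ∧ (t : ℝ) ≤ a) ?_
      refine IsClosed.inter (hA.preimage (f := fun z : Y × cantorSet => (z.1, cantorParam X z.2))
        ?_) (isClosed_le (f := fun z : Y × cantorSet => (z.2 : ℝ)) (by fun_prop)
          continuous_const)
      exact continuous_fst.prodMk ((continuous_cantorParam X).comp continuous_snd)
    have h2 : IsClosed {y : Y | ∃ x, A y x} := isClosed_setOf_exists hA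
    -- For an empty section the infimum takes the value `0`, whence the second set of the union.
    have : (fun y : Y => sInf ((↑) '' (cantorParam X ⁻¹' {x | A y x}) : Set ℝ)) ⁻¹' Iic a =
        {y : Y | ∃ t : cantorSet, A y (cantorParam X t) ∧ (t : ℝ) ≤ a} ∪
          ({y : Y | ∃ x, A y x}ᶜ ∩ {_y : Y | 0 ≤ a}) := by
      ext y
      by_cases hy : ∃ x, A y x
      · simp only [mem_preimage, mem_Iic, mem_union, mem_ofPred_eq, mem_inter_iff, mem_compl_iff, hy,
          not_true_eq_false, false_and, or_false]
        constructor
        · intro h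
          obtain ⟨t, ht, he⟩ := sInf_mem_of_isClosed (hcl y) hy
          exact ⟨t, ht, he ▸ h⟩
        · rintro ⟨t, ht, hta⟩
          have ht' : t ∈ cantorParam X ⁻¹' {x | A y x} := ht
          refine (csInf_le ?_ (mem_image_of_mem _ ht')).trans hta
          exact ⟨0, by rintro _ ⟨s, -, rfl⟩; exact (cantorSet_subset_unitInterval s.2).1⟩
      · have he : {x | A y x} = ∅ := by
          ext x; simpa using fun h => hy ⟨x, h⟩
        have hn : ¬ ∃ t : cantorSet, A y (cantorParam X t) ∧ (t : ℝ) ≤ a :=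
          fun ⟨t, h, _⟩ => hy ⟨_, h⟩
        simp only [mem_preimage, he, preimage_empty, image_empty, Real.sInf_empty, mem_Iic, mem_union,
          mem_ofPred_eq, hn, mem_inter_iff, mem_compl_iff, hy, not_false_eq_true, true_and, false_or]
    rw [this]
    exact h1.measurableSet.union (h2.measurableSet.compl.inter (MeasurableSet.const _))
  classical
  have hg : Measurable fun r : ℝ =>
      if h : r ∈ cantorSet then cantorParam X ⟨r, h⟩ else Classical.arbitrary X :=
    Measurable.dite (s := cantorSet) (continuous_cantorParam X).measurable measurable_const
      isClosed_cantorSet.measurableSet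
  exact hg.comp hm

end Selector

/-! ### Closed graphs and cluster points -/

/-- A closed relation between compact Hausdorff spaces which is the graph of a bijection is the
graph of a homeomorphism. -/
theorem exists_homeomorph_of_isClosed {X Y : Type*} [TopologicalSpace X] [CompactSpace X]
    [T2Space X] [TopologicalSpace Y] [CompactSpace Y]
    [T2Space Y] {R : X → Y → Prop}
    (hR : IsClosed {z : X × Y | R z.1 z.2}) (h₁ : ∀ x, ∃! y, R x y) (h₂ : ∀ y, ∃! x, R x y) :
    ∃ e : X ≃ₜ Y, ∀ x y, R x y ↔ e x = y := by
  choose f hf hf' using h₁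
  choose g hg hg' using h₂
  have hgf (x : X) : g (f x) = x := (hg' _ _ (hf x)).symm
  have hfg (y : Y) : f (g y) = y := (hf' _ _ (hg y)).symm
  have hcg : Continuous g := by
    refine continuous_iff_isClosed.2 fun s hs => ?_
    have : g ⁻¹' s = {y | ∃ x, R x y ∧ x ∈ s} := by
      ext y
      exact ⟨fun h => ⟨_, hg y, h⟩, fun ⟨x, h, hx⟩ => by rwa [hg' _ _ h] at hx⟩
    rw [this]
    exact isClosed_setOf_exists (A := fun y x => R x y ∧ x ∈ s)
      ((hR.preimage continuous_swap).inter (hs.preimage continuous_snd))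
  let e : Y ≃ X := ⟨g, f, hfg, hgf⟩
  refine ⟨(Continuous.homeoOfEquivCompactToT2 (f := e) hcg).symm, fun x y => ⟨?_, ?_⟩⟩
  · exact fun h => (hf' x y h).symm
  · rintro rfl
    exact hf x

/-! ### Components of a compact set as a closed relation on the hyperspace -/

section Components

variable {X : Type*}

theorem isClosed_setOf_mem [TopologicalSpace X] [T2Space X] :
    IsClosed {z : NonemptyCompacts X × X | z.2 ∈ z.1} := by
  rw [← isOpen_compl_iff, isOpen_iff_mem_nhds]
  rintro ⟨C, x⟩ hx
  obtain ⟨U, V, hU, hV, hCU, hxV, hUV⟩ := SeparatedNhds.of_isCompact_isCompact C.isCompact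
    (isCompact_singleton (x := x)) (disjoint_singleton_right.2 hx)
  filter_upwards [prod_mem_nhds ((NonemptyCompacts.isOpen_subsets_of_isOpen hU).mem_nhds hCU)
    (hV.mem_nhds (hxV rfl))] with z hz hz'
  exact disjoint_left.1 hUV (hz.1 hz') hz.2

theorem mem_of_mem_connectedComponentIn [TopologicalSpace X] {s : Set X} {x y : X}
    (h : y ∈ connectedComponentIn s x) : x ∈ s ∧ y ∈ s :=
  ⟨by_contra fun hx => by simp [connectedComponentIn_eq_empty hx] at h,
    connectedComponentIn_subset _ _ h⟩

theorem coe_mem_connectedComponentIn_iff [TopologicalSpace X] {C : NonemptyCompacts X}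
    {x y : {x // x ∈ C}} :
    (y : X) ∈ connectedComponentIn (C : Set X) x ↔ y ∈ connectedComponent x := by
  rw [connectedComponentIn_eq_image (F := (C : Set X)) x.2]
  exact ⟨fun ⟨z, hz, h⟩ => Subtype.ext h ▸ hz, fun h => ⟨y, h, rfl⟩⟩

theorem connectedComponentIn_congr [TopologicalSpace X] {s : Set X} {x y : X}
    (h : y ∈ connectedComponentIn s x) : connectedComponentIn s y = connectedComponentIn s x :=
  (connectedComponentIn_eq h).symm

theorem isOpen_setOf_exists_mem_inter [TopologicalSpace X] {U : Set X} (hU : IsOpen U) :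
    IsOpen {C : NonemptyCompacts X | ∃ x ∈ C, x ∈ U} :=
  NonemptyCompacts.isOpen_inter_nonempty_of_isOpen hU

/-- The relation "`x` and `y` lie in the same component of `C`" is closed in the triple
`(C, x, y)`: points of different components are separated by a partition of `C` into two relatively
open sets, and this partition persists for all compact sets near `C`. -/
theorem isClosed_setOf_mem_connectedComponentIn [TopologicalSpace X] [T2Space X] :
    IsClosed {z : NonemptyCompacts X × X × X |
      z.2.2 ∈ connectedComponentIn (z.1 : Set X) z.2.1} := by
  rw [← isOpen_compl_iff, isOpen_iff_mem_nhds]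
  rintro ⟨C, x, y⟩ hxy
  have hopen := (isClosed_setOf_mem (X := X)).isOpen_compl
  by_cases hx : x ∈ C
  swap
  · have hc : Continuous fun z : NonemptyCompacts X × X × X => (z.1, z.2.1) := by fun_prop
    filter_upwards [(hopen.preimage hc).mem_nhds (show (C, x, y) ∈ _ from hx)] with z hz h
    exact hz (mem_of_mem_connectedComponentIn h).1
  by_cases hy : y ∈ C
  swap
  · have hc : Continuous fun z : NonemptyCompacts X × X × X => (z.1, z.2.2) := by fun_prop
    filter_upwards [(hopen.preimage hc).mem_nhds (show (C, x, y) ∈ _ from hy)] with z hz h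
    exact hz (mem_of_mem_connectedComponentIn h).2
  have : CompactSpace {x // x ∈ C} := isCompact_iff_compactSpace.1 C.isCompact
  have hxy' : (⟨y, hy⟩ : {x // x ∈ C}) ∉ connectedComponent ⟨x, hx⟩ :=
    fun h => hxy (coe_mem_connectedComponentIn_iff.2 h)
  rw [connectedComponent_eq_iInter_isClopen, mem_iInter] at hxy'
  push Not at hxy'
  obtain ⟨⟨Z, hZ, hxZ⟩, hyZ⟩ := hxy'
  obtain ⟨U, V, hU, hV, hZU, hZV, hUV⟩ := SeparatedNhds.of_isCompact_isCompact
    (hZ.1.isCompact.image continuous_subtype_val)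
    (hZ.compl.1.isCompact.image continuous_subtype_val)
    ((disjoint_image_iff Subtype.val_injective).2 disjoint_compl_right)
  have hCUV : (C : Set X) ⊆ U ∪ V := fun z hz => by
    by_cases h : (⟨z, hz⟩ : {x // x ∈ C}) ∈ Z
    · exact Or.inl (hZU ⟨_, h, rfl⟩)
    · exact Or.inr (hZV ⟨_, h, rfl⟩)
  filter_upwards [prod_mem_nhds
    ((NonemptyCompacts.isOpen_subsets_of_isOpen (hU.union hV)).mem_nhds hCUV)
    (prod_mem_nhds (hU.mem_nhds (hZU ⟨_, hxZ, rfl⟩)) (hV.mem_nhds (hZV ⟨_, hyZ, rfl⟩)))]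
    with z hz h
  have hs : connectedComponentIn (z.1 : Set X) z.2.1 ⊆ U :=
    isPreconnected_connectedComponentIn.subset_left_of_subset_union hU hV hUV
      ((connectedComponentIn_subset _ _).trans hz.1)
      ⟨_, mem_connectedComponentIn (mem_of_mem_connectedComponentIn h).1, hz.2.1⟩
  exact disjoint_left.1 hUV (hs h) hz.2.2

/-- The point `x` lies in a component of `C` which is not `V`-small. In particular `x ∈ C`, as the
component in `C` of a point outside of `C` is empty by convention. -/
def InLargeComponent [TopologicalSpace X] (V : Set (X × X)) (C : NonemptyCompacts X) (x : X) :
    Prop :=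
  ∃ w : X × X, w.1 ∈ connectedComponentIn (C : Set X) x ∧
    w.2 ∈ connectedComponentIn (C : Set X) x ∧ w ∉ V

theorem InLargeComponent.mem [TopologicalSpace X] {V : Set (X × X)} {C : NonemptyCompacts X} {x : X}
    (h : InLargeComponent V C x) : x ∈ C :=
  let ⟨_, h, _⟩ := h
  (mem_of_mem_connectedComponentIn h).1

theorem InLargeComponent.congr [TopologicalSpace X] {V : Set (X × X)} {C : NonemptyCompacts X}
    {x y : X} (h : InLargeComponent V C x) (hxy : y ∈ connectedComponentIn (C : Set X) x) :
    InLargeComponent V C y := by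
  rwa [InLargeComponent, connectedComponentIn_congr hxy]

theorem inLargeComponent_coe_iff [TopologicalSpace X] {V : Set (X × X)} {C : NonemptyCompacts X}
    {x : {x // x ∈ C}} :
    InLargeComponent V C x ↔
      ¬ connectedComponent x ×ˢ connectedComponent x ⊆ Prod.map Subtype.val Subtype.val ⁻¹' V := by
  rw [not_subset]
  constructor
  · rintro ⟨w, h₁, h₂, hw⟩
    refine ⟨(⟨w.1, (mem_of_mem_connectedComponentIn h₁).2⟩,
      ⟨w.2, (mem_of_mem_connectedComponentIn h₂).2⟩), ⟨?_, ?_⟩, hw⟩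
    · exact coe_mem_connectedComponentIn_iff.1 h₁
    · exact coe_mem_connectedComponentIn_iff.1 h₂
  · rintro ⟨w, ⟨h₁, h₂⟩, hw⟩
    exact ⟨(w.1, w.2), coe_mem_connectedComponentIn_iff.2 h₁,
      coe_mem_connectedComponentIn_iff.2 h₂, hw⟩

theorem isClosed_setOf_inLargeComponent [TopologicalSpace X] [T2Space X] [CompactSpace X]
    {V : Set (X × X)} (hV : IsOpen V) :
    IsClosed {z : NonemptyCompacts X × X | InLargeComponent V z.1 z.2} := by
  have hR := isClosed_setOf_mem_connectedComponentIn (X := X)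
  refine isClosed_setOf_exists (Y := NonemptyCompacts X × X)
    (A := fun z w => w.1 ∈ connectedComponentIn (z.1 : Set X) z.2 ∧
      w.2 ∈ connectedComponentIn (z.1 : Set X) z.2 ∧ w ∉ V) ?_
  refine IsClosed.inter ?_ (IsClosed.inter ?_ (hV.isClosed_compl.preimage continuous_snd))
  · exact hR.preimage (f := fun z : (NonemptyCompacts X × X) × X × X => (z.1.1, z.1.2, z.2.1))
      (by fun_prop)
  · exact hR.preimage (f := fun z : (NonemptyCompacts X × X) × X × X => (z.1.1, z.1.2, z.2.2))
      (by fun_prop)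

end Components

/-! ### The Borel complexity of the defining properties of tame cantoroids -/

section Borel

variable {X : Type*} [UniformSpace X]

/-- A compact set has no isolated points if and only if each basic open set which meets it contains
two of its points. -/
theorem measurableSet_noIsolated [T2Space X] [CompactSpace X] [SecondCountableTopology X] :
    MeasurableSet {C : NonemptyCompacts X | ∀ x : {x // x ∈ C}, ¬ IsOpen {x}} := by
  have hB := isBasis_countableBasis X
  have : {C : NonemptyCompacts X | ∀ x : {x // x ∈ C}, ¬ IsOpen {x}} =
      ⋂ U ∈ countableBasis X, {C | ∃ x ∈ C, x ∈ U}ᶜ ∪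
        {C | ∃ w : X × X, (w.1 ∈ C ∧ w.2 ∈ C) ∧ (w.1 ∈ U ∧ w.2 ∈ U ∧ w.1 ≠ w.2)} := by
    ext C
    simp only [mem_ofPred_eq, mem_iInter, mem_union, mem_compl_iff]
    constructor
    · intro h U hU
      by_contra! hcon
      obtain ⟨⟨x, hxC, hxU⟩, hcon⟩ := hcon
      refine h ⟨x, hxC⟩ ?_
      convert (hB.isOpen hU).preimage (continuous_subtype_val (p := (· ∈ C)))
      ext y
      constructor
      · rintro rfl
        exact hxU
      · exact fun hy => Subtype.ext
          (hcon (y, x) ⟨y.2, hxC⟩ hy hxU)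
    · intro h x hx
      obtain ⟨O, hO, hOx⟩ := isOpen_induced_iff.1 hx
      have hxO : (x : X) ∈ O := show x ∈ Subtype.val ⁻¹' O from hOx ▸ mem_singleton x
      obtain ⟨U, hU, hxU, hUO⟩ := hB.exists_subset_of_mem_open hxO hO
      obtain h | ⟨⟨y, z⟩, ⟨hy, hz⟩, hyU, hzU, hne⟩ := h U hU
      · exact h ⟨x, x.2, hxU⟩
      · have key (y : X) (hy : y ∈ C) (hyU : y ∈ U) : (⟨y, hy⟩ : {x // x ∈ C}) = x := by
          have : (⟨y, hy⟩ : {x // x ∈ C}) ∈ Subtype.val ⁻¹' O := hUO hyU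
          rwa [hOx] at this
        exact hne (congrArg Subtype.val ((key y hy hyU).trans (key z hz hzU).symm))
  rw [this]
  refine MeasurableSet.biInter (countable_countableBasis X) fun U hU => ?_
  have hUo := hB.isOpen hU
  refine (isOpen_setOf_exists_mem_inter hUo).measurableSet.compl.union ?_
  have hc := isClosed_setOf_mem (X := X)
  refine measurableSet_setOf_exists (A := fun C (w : X × X) => w.1 ∈ C ∧ w.2 ∈ C)
    (B := fun _ w => w.1 ∈ U ∧ w.2 ∈ U ∧ w.1 ≠ w.2) ?_ ?_
  · exact (hc.preimage (f := fun z : NonemptyCompacts X × X × X => (z.1, z.2.1)) (by fun_prop)).inter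
      (hc.preimage (f := fun z : NonemptyCompacts X × X × X => (z.1, z.2.2)) (by fun_prop))
  · refine (hUo.preimage (f := fun z : NonemptyCompacts X × X × X => z.2.1) (by fun_prop)).inter
      ((hUo.preimage (f := fun z : NonemptyCompacts X × X × X => z.2.2) (by fun_prop)).inter ?_)
    exact (isClosed_eq (f := fun z : NonemptyCompacts X × X × X => z.2.1) (g := fun z => z.2.2)
      (by fun_prop) (by fun_prop)).isOpen_compl

/-- By the Baire category theorem the degenerate components have dense union if and only if, for
each member `V` of a countable basis of the uniformity, the open set of points in `V`-small
components is dense. -/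
theorem dense_degenerate_iff [T2Space X] [CompactSpace X]
    {V : ℕ → Set (X × X)} (hV : (𝓤 X).HasBasis (fun _ => True) V)
    (hVo : ∀ n, IsOpen (V n)) (C : NonemptyCompacts X) :
    Dense {x : {x // x ∈ C} | connectedComponent x = {x}} ↔
      ∀ n, Dense {x : {x // x ∈ C} | ¬ InLargeComponent (V n) C x} := by
  have : CompactSpace {x // x ∈ C} := isCompact_iff_compactSpace.1 C.isCompact
  have heq : {x : {x // x ∈ C} | connectedComponent x = {x}} =
      ⋂ n, {x : {x // x ∈ C} | ¬ InLargeComponent (V n) C x} := by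
    ext x
    simp only [mem_ofPred_eq, mem_iInter, inLargeComponent_coe_iff, not_not]
    constructor
    · rintro h n ⟨y, z⟩ ⟨hy, hz⟩
      rw [h] at hy hz
      obtain rfl : y = x := hy
      obtain rfl : z = y := hz
      exact refl_mem_uniformity (x := (z : X)) (hV.mem_of_mem (i := n) trivial)
    · refine fun h => Subset.antisymm (fun y hy => ?_) (singleton_subset_iff.2 mem_connectedComponent)
      refine Subtype.ext (eq_of_uniformity_basis hV fun {n} _ => ?_)
      exact @h n (y, x) ⟨hy, mem_connectedComponent⟩
  rw [heq]
  refine ⟨fun h n => h.mono (iInter_subset _ n), fun h => dense_iInter_of_isOpen (fun n => ?_) h⟩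
  exact ((isClosed_setOf_inLargeComponent (hVo n)).preimage
    (f := fun x : {x // x ∈ C} => (C, (x : X))) (by fun_prop)).isOpen_compl

theorem dense_setOf_coe_iff [SecondCountableTopology X] {C : NonemptyCompacts X} {P : X → Prop} :
    Dense {x : {x // x ∈ C} | P x} ↔
      ∀ U ∈ countableBasis X, (∃ x ∈ C, x ∈ U) → ∃ x, x ∈ C ∧ x ∈ U ∧ P x := by
  have hB := isBasis_countableBasis X
  rw [dense_iff_inter_open]
  constructor
  · rintro h U hU ⟨x, hx, hxU⟩
    obtain ⟨y, hy, hP⟩ := h _ ((hB.isOpen hU).preimage continuous_subtype_val) ⟨⟨x, hx⟩, hxU⟩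
    exact ⟨y, y.2, hy, hP⟩
  · rintro h O hO ⟨x, hx⟩
    obtain ⟨O, hO', rfl⟩ := isOpen_induced_iff.1 hO
    obtain ⟨U, hU, hxU, hUO⟩ := hB.exists_subset_of_mem_open (show (x : X) ∈ O from hx) hO'
    obtain ⟨y, hy, hyU, hP⟩ := h U hU ⟨x, x.2, hxU⟩
    exact ⟨⟨y, hy⟩, hUO hyU, hP⟩

theorem exists_basis_isOpen_uniformity [(𝓤 X).IsCountablyGenerated] :
    ∃ V : ℕ → Set (X × X), (𝓤 X).HasBasis (fun _ => True) V ∧ ∀ n, IsOpen (V n) := by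
  obtain ⟨V, hV, hb⟩ := (uniformity_hasBasis_open (α := X)).exists_antitone_subbasis
  exact ⟨V, hb.toHasBasis, fun n => (hV n).2⟩

theorem measurableSet_dense_degenerate [T2Space X] [CompactSpace X] [SecondCountableTopology X]
    [(𝓤 X).IsCountablyGenerated] :
    MeasurableSet {C : NonemptyCompacts X |
      Dense {x : {x // x ∈ C} | connectedComponent x = {x}}} := by
  obtain ⟨V, hV, hVo⟩ := exists_basis_isOpen_uniformity (X := X)
  have : {C : NonemptyCompacts X | Dense {x : {x // x ∈ C} | connectedComponent x = {x}}} =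
      ⋂ n, ⋂ U ∈ countableBasis X, {C | ∃ x ∈ C, x ∈ U}ᶜ ∪
        {C | ∃ x, x ∈ C ∧ x ∈ U ∧ ¬ InLargeComponent (V n) C x} := by
    ext C
    rw [mem_ofPred_eq, dense_degenerate_iff hV hVo, mem_iInter]
    refine forall_congr' fun n => ?_
    rw [dense_setOf_coe_iff (P := fun x => ¬ InLargeComponent (V n) C x), mem_iInter₂]
    exact forall₂_congr fun U _ => imp_iff_not_or
  rw [this]
  refine MeasurableSet.iInter fun n =>
    MeasurableSet.biInter (countable_countableBasis X) fun U hU => ?_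
  have hUo := (isBasis_countableBasis X).isOpen hU
  refine (isOpen_setOf_exists_mem_inter hUo).measurableSet.compl.union ?_
  exact measurableSet_setOf_exists (A := fun (C : NonemptyCompacts X) x => x ∈ C)
    (B := fun C x => x ∈ U ∧ ¬ InLargeComponent (V n) C x) isClosed_setOf_mem
    ((hUo.preimage continuous_snd).inter (isClosed_setOf_inLargeComponent (hVo n)).isOpen_compl)

/-- Only finitely many components of `C` are not `V`-small if and only if there is a bound on the
length of tuples of points which lie in distinct such components. -/
theorem finite_large_iff (V : Set (X × X)) (C : NonemptyCompacts X) :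
    {K : Set {x // x ∈ C} | (∃ x, K = connectedComponent x) ∧
      ¬ K ×ˢ K ⊆ Prod.map Subtype.val Subtype.val ⁻¹' V}.Finite ↔
    ∃ N : ℕ, ¬ ∃ x : Fin N → X, (∀ i, InLargeComponent V C (x i)) ∧
      ∀ i j, i ≠ j → x j ∉ connectedComponentIn (C : Set X) (x i) := by
  set S := {K : Set {x // x ∈ C} | (∃ x, K = connectedComponent x) ∧
      ¬ K ×ˢ K ⊆ Prod.map Subtype.val Subtype.val ⁻¹' V} with hS
  constructor
  · intro hfin
    have := hfin.fintype
    refine ⟨Fintype.card S + 1, ?_⟩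
    rintro ⟨x, hx, hne⟩
    let g : Fin (Fintype.card S + 1) → S := fun i =>
      ⟨connectedComponent ⟨x i, (hx i).mem⟩, ⟨_, rfl⟩, inLargeComponent_coe_iff.1 (hx i)⟩
    have hg : Function.Injective g := fun i j hij => by
      by_contra hij'
      refine hne i j hij' ?_
      refine coe_mem_connectedComponentIn_iff (x := ⟨x i, (hx i).mem⟩) (y := ⟨x j, (hx j).mem⟩).2 ?_
      rw [show connectedComponent _ = connectedComponent _ from congrArg Subtype.val hij]
      exact mem_connectedComponent
    simpa using Fintype.card_le_of_injective g hg
  · rintro ⟨N, hN⟩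
    by_contra hinf
    have : Infinite S := Set.infinite_coe_iff.2 hinf
    choose y hy using fun i : Fin N => (Infinite.natEmbedding S i).2.1
    have hyV (i : Fin N) := (Infinite.natEmbedding S i).2.2
    refine hN ⟨fun i => y i, fun i => ?_, fun i j hij h => hij ?_⟩
    · rw [inLargeComponent_coe_iff, ← hy i]
      exact hyV i
    · have h := connectedComponent_eq (coe_mem_connectedComponentIn_iff.1 h)
      rw [← hy i, ← hy j] at h
      exact Fin.ext ((Infinite.natEmbedding S).injective (Subtype.ext h))

/-- It suffices to test the null condition on a basis of the uniformity of the ambient space. -/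
theorem null_iff {V : ℕ → Set (X × X)} (hV : (𝓤 X).HasBasis (fun _ => True) V)
    (C : NonemptyCompacts X) :
    (∀ W ∈ 𝓤 {x // x ∈ C},
      {K : Set {x // x ∈ C} | (∃ x, K = connectedComponent x) ∧ ¬ K ×ˢ K ⊆ W}.Finite) ↔
    ∀ n, {K : Set {x // x ∈ C} | (∃ x, K = connectedComponent x) ∧
      ¬ K ×ˢ K ⊆ Prod.map Subtype.val Subtype.val ⁻¹' V n}.Finite := by
  have hb : (𝓤 {x // x ∈ C}).HasBasis (fun _ => True)
      fun n => Prod.map Subtype.val Subtype.val ⁻¹' V n := by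
    rw [uniformity_subtype]
    exact hV.comap _
  refine ⟨fun h n => h _ (hb.mem_of_mem trivial), fun h W hW => ?_⟩
  obtain ⟨n, -, hn⟩ := hb.mem_iff.1 hW
  exact (h n).subset fun K hK => ⟨hK.1, fun hs => hK.2 (hs.trans hn)⟩

theorem measurableSet_null [T2Space X] [CompactSpace X] [SecondCountableTopology X]
    [(𝓤 X).IsCountablyGenerated] :
    MeasurableSet {C : NonemptyCompacts X | ∀ V ∈ 𝓤 {x // x ∈ C},
      {K : Set {x // x ∈ C} | (∃ x, K = connectedComponent x) ∧ ¬ K ×ˢ K ⊆ V}.Finite} := by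
  obtain ⟨V, hV, hVo⟩ := exists_basis_isOpen_uniformity (X := X)
  simp only [null_iff hV, finite_large_iff, ofPred_forall, ofPred_exists]
  refine MeasurableSet.iInter fun n => MeasurableSet.iUnion fun N => MeasurableSet.compl ?_
  refine measurableSet_setOf_exists
    (A := fun C (x : Fin N → X) => ∀ i, InLargeComponent (V n) C (x i))
    (B := fun C x => ∀ i j, i ≠ j → x j ∉ connectedComponentIn (C : Set X) (x i)) ?_ ?_
  · rw [ofPred_forall]
    exact isClosed_iInter fun i => (isClosed_setOf_inLargeComponent (hVo n)).preimage
      (f := fun z : NonemptyCompacts X × (Fin N → X) => (z.1, z.2 i)) (by fun_prop)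
  · simp only [ofPred_forall]
    refine isOpen_iInter_of_finite fun i => isOpen_iInter_of_finite fun j =>
      isOpen_iInter_of_finite fun _ => ?_
    exact isClosed_setOf_mem_connectedComponentIn.isOpen_compl.preimage
      (f := fun z : NonemptyCompacts X × (Fin N → X) => (z.1, z.2 i, z.2 j)) (by fun_prop)

theorem measurableSet_exists_nontrivial [T2Space X] [CompactSpace X] [SecondCountableTopology X] :
    MeasurableSet {C : NonemptyCompacts X |
      ∃ x : {x // x ∈ C}, (connectedComponent x).Nontrivial} := by
  have : {C : NonemptyCompacts X | ∃ x : {x // x ∈ C}, (connectedComponent x).Nontrivial} =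
      {C : NonemptyCompacts X | ∃ w : X × X, w.2 ∈ connectedComponentIn (C : Set X) w.1 ∧ w.1 ≠ w.2} := by
    ext C
    constructor
    · rintro ⟨x, hx⟩
      obtain ⟨y, hy, hne⟩ := hx.exists_ne x
      exact ⟨(x, y), coe_mem_connectedComponentIn_iff.2 hy, fun h => hne (Subtype.ext h.symm)⟩
    · rintro ⟨⟨x, y⟩, h, hne⟩
      have hxy := mem_of_mem_connectedComponentIn h
      refine ⟨⟨x, hxy.1⟩, ⟨x, hxy.1⟩, mem_connectedComponent, ⟨y, hxy.2⟩, ?_, ?_⟩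
      · exact coe_mem_connectedComponentIn_iff.1 h
      · exact fun he => hne (congrArg Subtype.val he)
  rw [this]
  exact measurableSet_setOf_exists
    (A := fun (C : NonemptyCompacts X) (w : X × X) => w.2 ∈ connectedComponentIn (C : Set X) w.1)
    (B := fun _ w => w.1 ≠ w.2) isClosed_setOf_mem_connectedComponentIn
    (isClosed_eq (f := fun z : NonemptyCompacts X × X × X => z.2.1) (g := fun z => z.2.2)
      (by fun_prop) (by fun_prop)).isOpen_compl

end Borel

/-! ### The set of systems is Borel -/

namespace SystemCode

instance (p : SystemCode) : CompactSpace p.space := isCompact_iff_compactSpace.1 p.1.isCompact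

instance (p : SystemCode) : MetrizableSpace p.space := IsEmbedding.subtypeVal.metrizableSpace

instance (p : SystemCode) : Nonempty p.space := p.1.nonempty.to_subtype

theorem Codes.mem_iff {p : SystemCode} {h : p.space ≃ₜ p.space} (H : p.Codes h) {x y : p.space} :
    ((x : HilbertCube), (y : HilbertCube)) ∈ p.2 ↔ h x = y := by
  rw [← SetLike.mem_coe, H]
  constructor
  · rintro ⟨z, hz⟩
    obtain ⟨h₁, h₂⟩ := Prod.mk.inj hz
    obtain rfl := Subtype.ext h₁
    exact Subtype.ext h₂
  · rintro rfl
    exact ⟨x, rfl⟩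

theorem Codes.mem_space {p : SystemCode} {h : p.space ≃ₜ p.space} (H : p.Codes h)
    {w : HilbertCube × HilbertCube} (hw : w ∈ p.2) : w.1 ∈ p.1 ∧ w.2 ∈ p.1 := by
  rw [← SetLike.mem_coe, H] at hw
  obtain ⟨z, rfl⟩ := hw
  exact ⟨z.2, (h z).2⟩

/-- As its graph is compact, a bijection coded by `p` is automatically a homeomorphism, so it
suffices to express that the second entry of `p` is the graph of a bijection of the first one. -/
theorem exists_codes_iff (p : SystemCode) :
    (∃ h, p.Codes h) ↔
      (¬ ∃ w, w ∈ p.2 ∧ (w.1 ∉ p.1 ∨ w.2 ∉ p.1)) ∧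
      (¬ ∃ x, x ∈ p.1 ∧ ∀ y, (x, y) ∉ p.2) ∧ (¬ ∃ y, y ∈ p.1 ∧ ∀ x, (x, y) ∉ p.2) ∧
      (¬ ∃ w : HilbertCube × HilbertCube × HilbertCube,
        ((w.1, w.2.1) ∈ p.2 ∧ (w.1, w.2.2) ∈ p.2) ∧ w.2.1 ≠ w.2.2) ∧
      ¬ ∃ w : HilbertCube × HilbertCube × HilbertCube,
        ((w.2.1, w.1) ∈ p.2 ∧ (w.2.2, w.1) ∈ p.2) ∧ w.2.1 ≠ w.2.2 := by
  constructor
  · rintro ⟨h, H⟩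
    refine ⟨?_, ?_, ?_, ?_, ?_⟩
    · rintro ⟨w, hw, h' | h'⟩
      · exact h' (H.mem_space hw).1
      · exact h' (H.mem_space hw).2
    · rintro ⟨x, hx, hxy⟩
      exact hxy _ (H.mem_iff (x := ⟨x, hx⟩).2 rfl)
    · rintro ⟨y, hy, hxy⟩
      exact hxy _ (H.mem_iff (y := ⟨y, hy⟩).2 (h.apply_symm_apply _))
    · rintro ⟨⟨x, y, z⟩, ⟨hy, hz⟩, hne⟩
      have h₁ := H.mem_iff (x := ⟨x, (H.mem_space hy).1⟩) (y := ⟨y, (H.mem_space hy).2⟩).1 hy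
      have h₂ := H.mem_iff (x := ⟨x, (H.mem_space hy).1⟩) (y := ⟨z, (H.mem_space hz).2⟩).1 hz
      exact hne (congrArg Subtype.val (h₁.symm.trans h₂))
    · rintro ⟨⟨x, y, z⟩, ⟨hy, hz⟩, hne⟩
      have h₁ := H.mem_iff (x := ⟨y, (H.mem_space hy).1⟩) (y := ⟨x, (H.mem_space hy).2⟩).1 hy
      have h₂ := H.mem_iff (x := ⟨z, (H.mem_space hz).1⟩) (y := ⟨x, (H.mem_space hy).2⟩).1 hz
      exact hne (congrArg Subtype.val (h.injective (h₁.trans h₂.symm)))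
  · rintro ⟨h₁, h₂, h₃, h₄, h₅⟩
    push Not at h₁ h₂ h₃ h₄ h₅
    have hx (x : p.space) : ∃! y : p.space, ((x : HilbertCube), (y : HilbertCube)) ∈ p.2 := by
      obtain ⟨y, hy⟩ := h₂ x x.2
      exact ⟨⟨y, (h₁ _ hy).2⟩, hy, fun z hz => Subtype.ext (h₄ (x, z, y) ⟨hz, hy⟩)⟩
    have hy (y : p.space) : ∃! x : p.space, ((x : HilbertCube), (y : HilbertCube)) ∈ p.2 := by
      obtain ⟨x, hx⟩ := h₃ y y.2
      exact ⟨⟨x, (h₁ _ hx).1⟩, hx, fun z hz => Subtype.ext (h₅ (y, z, x) ⟨hz, hx⟩)⟩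
    obtain ⟨e, he⟩ := exists_homeomorph_of_isClosed (X := p.space) (Y := p.space)
      (R := fun x y => ((x : HilbertCube), (y : HilbertCube)) ∈ p.2)
      (p.2.isCompact.isClosed.preimage (f := fun z : p.space × p.space =>
        ((z.1 : HilbertCube), (z.2 : HilbertCube))) (by fun_prop))
      hx hy
    refine ⟨e, Set.ext fun w => ⟨fun hw => ?_, ?_⟩⟩
    · have := (he ⟨w.1, (h₁ w hw).1⟩ ⟨w.2, (h₁ w hw).2⟩).1 hw
      exact ⟨⟨w.1, (h₁ w hw).1⟩, Prod.ext rfl (congrArg Subtype.val this)⟩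
    · rintro ⟨x, rfl⟩
      exact (he x _).2 rfl

theorem isClosed_setOf_mem_fst : IsClosed {z : SystemCode × HilbertCube | z.2 ∈ z.1.1} :=
  isClosed_setOf_mem.preimage (f := fun z : SystemCode × HilbertCube => (z.1.1, z.2)) (by fun_prop)

theorem isClosed_setOf_mem_snd :
    IsClosed {z : SystemCode × HilbertCube × HilbertCube | z.2 ∈ z.1.2} :=
  isClosed_setOf_mem.preimage
    (f := fun z : SystemCode × HilbertCube × HilbertCube => (z.1.2, z.2)) (by fun_prop)

theorem measurableSet_exists_codes : MeasurableSet {p : SystemCode | ∃ h, p.Codes h} := by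
  have h₁ := isClosed_setOf_mem_fst
  have h₂ := isClosed_setOf_mem_snd
  have hne : IsOpen {z : SystemCode × HilbertCube × HilbertCube × HilbertCube |
      z.2.2.1 ≠ z.2.2.2} :=
    (isClosed_eq (f := fun z : SystemCode × HilbertCube × HilbertCube × HilbertCube => z.2.2.1)
      (g := fun z => z.2.2.2) (by fun_prop) (by fun_prop)).isOpen_compl
  simp only [exists_codes_iff]
  refine (MeasurableSet.compl ?_).inter ((MeasurableSet.compl ?_).inter
    ((MeasurableSet.compl ?_).inter ((MeasurableSet.compl ?_).inter (MeasurableSet.compl ?_))))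
  · refine measurableSet_setOf_exists (A := fun (p : SystemCode) w => w ∈ p.2)
      (B := fun p w => w.1 ∉ p.1 ∨ w.2 ∉ p.1) h₂ (IsOpen.union ?_ ?_)
    · exact h₁.isOpen_compl.preimage
        (f := fun z : SystemCode × HilbertCube × HilbertCube => (z.1, z.2.1)) (by fun_prop)
    · exact h₁.isOpen_compl.preimage
        (f := fun z : SystemCode × HilbertCube × HilbertCube => (z.1, z.2.2)) (by fun_prop)
  · refine measurableSet_setOf_exists (A := fun (p : SystemCode) x => x ∈ p.1)
      (B := fun p x => ∀ y, (x, y) ∉ p.2) h₁ (isOpen_setOf_forall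
        (A := fun (z : SystemCode × HilbertCube) y => (z.2, y) ∉ z.1.2) ?_)
    exact h₂.isOpen_compl.preimage
      (f := fun z : (SystemCode × HilbertCube) × HilbertCube => (z.1.1, z.1.2, z.2)) (by fun_prop)
  · refine measurableSet_setOf_exists (A := fun (p : SystemCode) x => x ∈ p.1)
      (B := fun p y => ∀ x, (x, y) ∉ p.2) h₁ (isOpen_setOf_forall
        (A := fun (z : SystemCode × HilbertCube) x => (x, z.2) ∉ z.1.2) ?_)
    exact h₂.isOpen_compl.preimage
      (f := fun z : (SystemCode × HilbertCube) × HilbertCube => (z.1.1, z.2, z.1.2)) (by fun_prop)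
  · refine measurableSet_setOf_exists
      (A := fun (p : SystemCode) (w : HilbertCube × HilbertCube × HilbertCube) =>
        (w.1, w.2.1) ∈ p.2 ∧ (w.1, w.2.2) ∈ p.2) (B := fun _ w => w.2.1 ≠ w.2.2)
      (IsClosed.inter ?_ ?_) hne
    · exact h₂.preimage (f := fun z : SystemCode × HilbertCube × HilbertCube × HilbertCube =>
        (z.1, z.2.1, z.2.2.1)) (by fun_prop)
    · exact h₂.preimage (f := fun z : SystemCode × HilbertCube × HilbertCube × HilbertCube =>
        (z.1, z.2.1, z.2.2.2)) (by fun_prop)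
  · refine measurableSet_setOf_exists
      (A := fun (p : SystemCode) (w : HilbertCube × HilbertCube × HilbertCube) =>
        (w.2.1, w.1) ∈ p.2 ∧ (w.2.2, w.1) ∈ p.2) (B := fun _ w => w.2.1 ≠ w.2.2)
      (IsClosed.inter ?_ ?_) hne
    · exact h₂.preimage (f := fun z : SystemCode × HilbertCube × HilbertCube × HilbertCube =>
        (z.1, z.2.2.1, z.2.1)) (by fun_prop)
    · exact h₂.preimage (f := fun z : SystemCode × HilbertCube × HilbertCube × HilbertCube =>
        (z.1, z.2.2.2, z.2.1)) (by fun_prop)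

/-- Some orbit of the relation coded by `p` stays outside of `U`. Orbits range over a compact
space, so that this is a closed condition on `p`. -/
def HasOrbitAvoiding (p : SystemCode) (U : Set HilbertCube) : Prop :=
  ∃ x : ℕ → HilbertCube, ∀ k, (x k, x (k + 1)) ∈ p.2 ∧ x k ∉ U

theorem isClosed_setOf_hasOrbitAvoiding {U : Set HilbertCube} (hU : IsOpen U) :
    IsClosed {p : SystemCode | p.HasOrbitAvoiding U} := by
  refine isClosed_setOf_exists (A := fun (p : SystemCode) (x : ℕ → HilbertCube) =>
    ∀ k, (x k, x (k + 1)) ∈ p.2 ∧ x k ∉ U) ?_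
  rw [ofPred_forall]
  refine isClosed_iInter fun k => IsClosed.inter ?_ ?_
  · exact isClosed_setOf_mem_snd.preimage
      (f := fun z : SystemCode × (ℕ → HilbertCube) => (z.1, z.2 k, z.2 (k + 1))) (by fun_prop)
  · exact hU.isClosed_compl.preimage
      (f := fun z : SystemCode × (ℕ → HilbertCube) => z.2 k) (by fun_prop)

/-- A coded homeomorphism is minimal if and only if no orbit avoids a basic open set which meets the
space. -/
theorem Codes.isMinimalMap_iff {p : SystemCode} {h : p.space ≃ₜ p.space} (H : p.Codes h) :
    IsMinimalMap h ↔ ∀ U ∈ countableBasis HilbertCube,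
      (∃ x ∈ p.1, x ∈ U) → ¬ p.HasOrbitAvoiding U := by
  have hB := isBasis_countableBasis HilbertCube
  constructor
  · rintro hm U hU ⟨x, hx, hxU⟩ ⟨y, hy⟩
    have hyC (k : ℕ) : y k ∈ p.1 := (H.mem_space (hy k).1).1
    have horb (k : ℕ) : h^[k] ⟨y 0, hyC 0⟩ = ⟨y k, hyC k⟩ := by
      induction k with
      | zero => rfl
      | succ k ih =>
        rw [Function.iterate_succ_apply', ih]
        exact H.mem_iff.1 (hy k).1
    obtain ⟨_, hz, k, rfl⟩ := (hm ⟨y 0, hyC 0⟩).inter_open_nonempty _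
      ((hB.isOpen hU).preimage continuous_subtype_val) ⟨⟨x, hx⟩, hxU⟩
    simp only [horb] at hz
    exact (hy k).2 hz
  · intro hU x
    refine dense_iff_inter_open.2 ?_
    rintro O hO ⟨y, hy⟩
    obtain ⟨O, hO', rfl⟩ := isOpen_induced_iff.1 hO
    obtain ⟨U, hUB, hyU, hUO⟩ := hB.exists_subset_of_mem_open (show (y : HilbertCube) ∈ O from hy)
      hO'
    by_contra hcon
    refine hU U hUB ⟨y, y.2, hyU⟩ ⟨fun k => h^[k] x, fun k => ⟨?_, fun hk => hcon ?_⟩⟩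
    · rw [H.mem_iff, Function.iterate_succ_apply']
    · exact ⟨h^[k] x, hUO hk, k, rfl⟩

end SystemCode

/-- A compact metrizable space without isolated points is a Cantor space if and only if all of its
components are degenerate. -/
theorem isCantorSpace_iff {X : Type*} [TopologicalSpace X] [CompactSpace X] [MetrizableSpace X]
    [Nonempty X] (hX : ∀ x : X, ¬ IsOpen ({x} : Set X)) :
    IsCantorSpace X ↔ ¬ ∃ x : X, (connectedComponent x).Nontrivial := by
  rw [← not_iff_not, not_not, ← not_iff_not, not_not]
  have htd : (¬ ∃ x : X, (connectedComponent x).Nontrivial) ↔ TotallyDisconnectedSpace X := by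
    rw [totallyDisconnectedSpace_iff_connectedComponent_subsingleton]
    simp only [not_exists, not_nontrivial_iff]
  rw [htd]
  constructor
  · intro h
    have := totallySeparatedSpace_of_t0_of_basis_clopen h.zeroDimensional
    infer_instance
  · intro h
    exact ⟨‹_›, ‹_›, ‹_›, isTopologicalBasis_isClopen, hX⟩

theorem minimalTameSystems_eq : minimalTameSystems =
    {p : SystemCode | (∀ x : p.space, ¬ IsOpen {x}) ∧
      (Dense {x : p.space | connectedComponent x = {x}}) ∧
      (∀ V ∈ 𝓤 p.space,
        {K : Set p.space | (∃ x, K = connectedComponent x) ∧ ¬ K ×ˢ K ⊆ V}.Finite) ∧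
      (∃ x : p.space, (connectedComponent x).Nontrivial) ∧ (∃ h, p.Codes h) ∧
      ∀ U ∈ countableBasis HilbertCube, (∃ x ∈ p.1, x ∈ U) → ¬ p.HasOrbitAvoiding U} := by
  ext p
  constructor
  · rintro ⟨ht, hc, h, H, hm⟩
    refine ⟨ht.noIsolated, ht.dense_degenerate, ht.null, ?_, ⟨h, H⟩, H.isMinimalMap_iff.1 hm⟩
    rwa [isCantorSpace_iff ht.noIsolated, not_not] at hc
  · rintro ⟨h₁, h₂, h₃, h₄, ⟨h, H⟩, h₅⟩
    refine ⟨⟨⟨inferInstance, inferInstance, inferInstance, h₂, h₁⟩, h₃⟩, ?_, h, H,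
      H.isMinimalMap_iff.2 h₅⟩
    rwa [isCantorSpace_iff h₁, not_not]

theorem measurableSet_minimalTameSystems : MeasurableSet minimalTameSystems := by
  have hmin : MeasurableSet {p : SystemCode | ∀ U ∈ countableBasis HilbertCube,
      (∃ x ∈ p.1, x ∈ U) → ¬ p.HasOrbitAvoiding U} := by
    simp only [ofPred_forall]
    refine MeasurableSet.biInter (countable_countableBasis _) fun U hU => ?_
    have hUo := (isBasis_countableBasis HilbertCube).isOpen hU
    simp only [imp_iff_not_or]
    exact ((isOpen_setOf_exists_mem_inter hUo).measurableSet.preimage measurable_fst).compl.union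
      (SystemCode.isClosed_setOf_hasOrbitAvoiding hUo).measurableSet.compl
  rw [minimalTameSystems_eq]
  exact (measurableSet_noIsolated.preimage measurable_fst).inter
    ((measurableSet_dense_degenerate.preimage measurable_fst).inter
    ((measurableSet_null.preimage measurable_fst).inter
    ((measurableSet_exists_nontrivial.preimage measurable_fst).inter
    (SystemCode.measurableSet_exists_codes.inter hmin))))

/-! ### The relation `E_tt` -/

/-- Every subsequence along which `a` converges is one along which `b` converges. -/
def ConvergesAlong {X Y : Type*} [TopologicalSpace X] [TopologicalSpace Y] (a : ℕ → X) (b : ℕ → Y) :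
    Prop :=
  ∀ n : ℕ → ℕ, StrictMono n →
    (∃ l, Tendsto (fun k => a (n k)) atTop (𝓝 l)) → ∃ l, Tendsto (fun k => b (n k)) atTop (𝓝 l)

theorem ettSetoid_r_iff {X : Type*} [TopologicalSpace X] {a b : ℕ → X} :
    (ettSetoid X).r a b ↔ ConvergesAlong a b ∧ ConvergesAlong b a :=
  ⟨fun h => ⟨fun n hn => (h n hn).1, fun n hn => (h n hn).2⟩,
    fun h n hn => ⟨h.1 n hn, h.2 n hn⟩⟩

theorem StrictMono.map_atTop_eq {n : ℕ → ℕ} (hn : StrictMono n) :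
    map n atTop = atTop ⊓ 𝓟 (range n) := by
  rw [← map_comap, comap_embedding_atTop (fun _ _ => hn.le_iff_le) fun c => ⟨c, hn.le_apply⟩]

/-- A common subsequence of two subsequences, obtained by merging their index sets, shows that a
cluster point of `b` is determined by the corresponding cluster point of `a`. -/
theorem ConvergesAlong.eq_of_mapClusterPt {X Y : Type*} [TopologicalSpace X]
    [FirstCountableTopology X] [TopologicalSpace Y] [FirstCountableTopology Y] [T2Space Y]
    {a : ℕ → X} {b : ℕ → Y} (h : ConvergesAlong a b) {x : X} {y y' : Y}
    (hy : MapClusterPt (x, y) atTop fun k => (a k, b k))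
    (hy' : MapClusterPt (x, y') atTop fun k => (a k, b k)) : y = y' := by
  obtain ⟨m, hm, hmt⟩ := hy.tendsto_subseq
  obtain ⟨m', hm', hmt'⟩ := hy'.tendsto_subseq
  have hinf : (range m ∪ range m').Infinite := (infinite_range_of_injective hm.injective).mono
    subset_union_left
  have hn := Nat.nth_strictMono (p := (· ∈ range m ∪ range m')) hinf
  have hr : map (Nat.nth (· ∈ range m ∪ range m')) atTop = map m atTop ⊔ map m' atTop := by
    have hrange : range (Nat.nth (· ∈ range m ∪ range m')) = range m ∪ range m' :=
      Nat.range_nth_of_infinite hinf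
    rw [hn.map_atTop_eq, hm.map_atTop_eq, hm'.map_atTop_eq, hrange, ← inf_sup_left, sup_principal]
  obtain ⟨l, hl⟩ := h _ hn ⟨x, by
    change Tendsto (a ∘ _) _ _
    rw [← tendsto_map'_iff, hr]
    exact tendsto_sup.2 ⟨tendsto_map'_iff.2 hmt.fst_nhds, tendsto_map'_iff.2 hmt'.fst_nhds⟩⟩
  change Tendsto (b ∘ _) _ _ at hl
  rw [← tendsto_map'_iff, hr, tendsto_sup, tendsto_map'_iff, tendsto_map'_iff] at hl
  exact (tendsto_nhds_unique hmt.snd_nhds hl.1).trans (tendsto_nhds_unique hmt'.snd_nhds hl.2).symm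

/-- In compact metrizable spaces, `b` converges along the subsequences along which `a` converges if
and only if, for large indices, closeness of terms of `a` entails closeness of the terms of `b`. -/
theorem convergesAlong_iff_tendsto {X Y : Type*} [UniformSpace X] [CompactSpace X] [T2Space X]
    [FirstCountableTopology X] [UniformSpace Y] [CompactSpace Y] [T2Space Y]
    [FirstCountableTopology Y] {a : ℕ → X} {b : ℕ → Y} :
    ConvergesAlong a b ↔ Tendsto (fun i : ℕ × ℕ => (b i.1, b i.2))
      (atTop ×ˢ atTop ⊓ comap (fun i : ℕ × ℕ => (a i.1, a i.2)) (𝓤 X)) (𝓤 Y) := by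
  constructor
  · intro h
    -- Along an ultrafilter all four coordinate sequences converge.
    rw [tendsto_iff_ultrafilter]
    intro u hu
    have hlimX (c : ℕ × ℕ → X) : ∃ z, Tendsto c u (𝓝 z) := ⟨_, (u.map c).le_nhds_lim⟩
    have hlimY (c : ℕ × ℕ → Y) : ∃ z, Tendsto c u (𝓝 z) := ⟨_, (u.map c).le_nhds_lim⟩
    obtain ⟨x, hx⟩ := hlimX fun i => a i.1
    obtain ⟨x', hx'⟩ := hlimX fun i => a i.2
    obtain ⟨y, hy⟩ := hlimY fun i => b i.1
    obtain ⟨y', hy'⟩ := hlimY fun i => b i.2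
    have hfst : Tendsto Prod.fst (u : Filter (ℕ × ℕ)) atTop :=
      tendsto_fst.mono_left (hu.trans inf_le_left)
    have hsnd : Tendsto Prod.snd (u : Filter (ℕ × ℕ)) atTop :=
      tendsto_snd.mono_left (hu.trans inf_le_left)
    have hxx : x = x' := by
      have h₁ : Tendsto (fun i : ℕ × ℕ => (a i.1, a i.2)) u (𝓤 X) :=
        tendsto_comap.mono_left (hu.trans inf_le_right)
      exact eq_of_clusterPt_uniformity (((hx.prodMk_nhds hx').mapClusterPt).clusterPt.mono h₁)
    subst hxx
    obtain rfl : y = y' := h.eq_of_mapClusterPt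
      (MapClusterPt.of_comp hfst (hx.prodMk_nhds hy).mapClusterPt)
      (MapClusterPt.of_comp hsnd (hx'.prodMk_nhds hy').mapClusterPt)
    exact (hy.prodMk_nhds hy').mono_right (nhds_le_uniformity y)
  · intro h n hn ⟨l, hl⟩
    refine cauchySeq_tendsto_of_complete (cauchySeq_iff_tendsto.2 ?_)
    refine h.comp (f := Prod.map n n) (tendsto_inf.2 ⟨?_, tendsto_comap_iff.2 ?_⟩)
    · rw [← prod_atTop_atTop_eq]
      exact hn.tendsto_atTop.prodMap hn.tendsto_atTop
    · exact cauchySeq_iff_tendsto.1 hl.cauchySeq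

/-- The relation `E_tt` is Borel on a compact metrizable space. -/
theorem measurableSet_ettSetoid {X Z : Type*} [UniformSpace X] [CompactSpace X] [T2Space X]
    [SecondCountableTopology X] [(𝓤 X).IsCountablyGenerated] [MeasurableSpace X] [BorelSpace X]
    [MeasurableSpace Z] {a b : Z → ℕ → X} (ha : ∀ k, Measurable fun z => a z k)
    (hb : ∀ k, Measurable fun z => b z k) : MeasurableSet {z | (ettSetoid X).r (a z) (b z)} := by
  obtain ⟨V, hV, hVo⟩ := exists_basis_isOpen_uniformity (X := X)
  suffices H : ∀ a b : Z → ℕ → X, (∀ k, Measurable fun z => a z k) →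
      (∀ k, Measurable fun z => b z k) → MeasurableSet {z | ConvergesAlong (a z) (b z)} by
    simp only [ettSetoid_r_iff]
    exact (H a b ha hb).inter (H b a hb ha)
  intro a b ha hb
  have hbasis (z : Z) := (atTop_basis (α := ℕ)).prod_self.inf
    (hV.comap fun i : ℕ × ℕ => (a z i.1, a z i.2))
  have : {z | ConvergesAlong (a z) (b z)} = ⋂ n, ⋃ w : ℕ × ℕ, ⋂ i ∈ Ici w.1 ×ˢ Ici w.1,
      {z | (a z i.1, a z i.2) ∈ V w.2}ᶜ ∪ {z | (b z i.1, b z i.2) ∈ V n} := by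
    ext z
    simp only [mem_ofPred_eq, convergesAlong_iff_tendsto, (hbasis z).tendsto_iff hV, mem_iInter,
      mem_iUnion, mem_union, mem_compl_iff, true_and, and_true, forall_const, Prod.forall,
      mem_inter_iff, mem_preimage, imp_iff_not_or]
    simp only [not_and_or, or_assoc]
  rw [this]
  refine MeasurableSet.iInter fun n => MeasurableSet.iUnion fun w =>
    MeasurableSet.biInter (to_countable _) fun i _ => ?_
  exact (((ha i.1).prodMk (ha i.2)) (hVo w.2).measurableSet).compl.union
    (((hb i.1).prodMk (hb i.2)) (hVo n).measurableSet)

/-! ### Minimal homeomorphisms with equivalent orbits are conjugate -/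

/-- The orbit of `h^[N] x` is dense for every `N`, so that every point is a cluster point of the
orbit of `x`. -/
theorem IsMinimalMap.mapClusterPt {X : Type*} [TopologicalSpace X] {h : X → X}
    (hm : IsMinimalMap h) (x l : X) : MapClusterPt l atTop fun k : ℕ => h^[k] x := by
  refine mapClusterPt_iff_frequently.2 fun U hU => frequently_atTop.2 fun N => ?_
  obtain ⟨_, ⟨k, rfl⟩, hk⟩ := (hm (h^[N] x)).inter_nhds_nonempty hU
  exact ⟨k + N, Nat.le_add_left _ _, by rwa [Function.iterate_add_apply]⟩

theorem IsMinimalMap.exists_mapClusterPt {X Y : Type*} [TopologicalSpace X]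
    [FirstCountableTopology X] [TopologicalSpace Y] {h : X → X} (hm : IsMinimalMap h) {x : X}
    {b : ℕ → Y} (hab : ConvergesAlong (fun k => h^[k] x) b) (l : X) :
    ∃ l', MapClusterPt (l, l') atTop fun k => (h^[k] x, b k) := by
  obtain ⟨n, hn, hl⟩ := (hm.mapClusterPt x l).tendsto_subseq
  obtain ⟨l', hl'⟩ := hab n hn ⟨l, hl⟩
  exact ⟨l', MapClusterPt.of_comp hn.tendsto_atTop (hl.prodMk_nhds hl').mapClusterPt⟩

/-- The set of cluster points of the sequence of pairs `(h^k x, g^k y)` is the graph of a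
conjugacy. -/
theorem IsMinimalMap.exists_conjugacy {X Y : Type*} [TopologicalSpace X] [CompactSpace X]
    [T2Space X] [FirstCountableTopology X] [TopologicalSpace Y] [CompactSpace Y] [T2Space Y]
    [FirstCountableTopology Y] {h : X → X} {g : Y → Y} (hh : Continuous h) (hg : Continuous g)
    (hm : IsMinimalMap h) (gm : IsMinimalMap g) {x : X} {y : Y}
    (hxy : ConvergesAlong (fun k => h^[k] x) fun k => g^[k] y)
    (hyx : ConvergesAlong (fun k => g^[k] y) fun k => h^[k] x) :
    ∃ φ : X ≃ₜ Y, ∀ z, φ (h z) = g (φ z) := by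
  let R (l : X) (l' : Y) : Prop := MapClusterPt (l, l') atTop fun k => (h^[k] x, g^[k] y)
  have hswap (l : X) (l' : Y) (H : MapClusterPt (l', l) atTop fun k => (g^[k] y, h^[k] x)) :
      R l l' := H.tendsto_comp (continuous_swap.tendsto (l', l))
  have hswap' (l : X) (l' : Y) (H : R l l') :
      MapClusterPt (l', l) atTop fun k => (g^[k] y, h^[k] x) :=
    MapClusterPt.tendsto_comp (continuous_swap.tendsto (l, l')) H
  obtain ⟨φ, hφ⟩ := exists_homeomorph_of_isClosed (R := R) isClosed_setOfPred_clusterPt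
    (fun l => by
      obtain ⟨l', hl'⟩ := hm.exists_mapClusterPt hxy l
      exact ⟨l', hl', fun m hm => hxy.eq_of_mapClusterPt hm hl'⟩)
    (fun l' => by
      obtain ⟨l, hl⟩ := gm.exists_mapClusterPt hyx l'
      exact ⟨l, hswap _ _ hl, fun m hm => hyx.eq_of_mapClusterPt (hswap' _ _ hm) hl⟩)
  refine ⟨φ, fun z => (hφ _ _).1 ?_⟩
  have hz : R z (φ z) := (hφ _ _).2 rfl
  have hc := MapClusterPt.tendsto_comp ((hh.prodMap hg).tendsto (z, φ z)) hz
  refine MapClusterPt.of_comp (tendsto_add_atTop_nat 1) ?_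
  have heq : ((fun k => (h^[k] x, g^[k] y)) ∘ fun k => k + 1) =
      Prod.map h g ∘ fun k => (h^[k] x, g^[k] y) := by
    funext k
    simp [Function.iterate_succ_apply']
  rwa [heq]

/-! ### Orbits of nondegenerate components -/

theorem Homeomorph.image_connectedComponent_eq {X Y : Type*} [TopologicalSpace X]
    [TopologicalSpace Y] (h : X ≃ₜ Y) (x : X) :
    h '' connectedComponent x = connectedComponent (h x) := by
  have := h.image_connectedComponentIn (mem_univ x)
  rwa [image_univ, h.surjective.range_eq, connectedComponentIn_univ, connectedComponentIn_univ]
    at this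

theorem Homeomorph.image_iterate_connectedComponent {X : Type*} [TopologicalSpace X] (h : X ≃ₜ X)
    (k : ℕ) (x : X) : h^[k] '' connectedComponent x = connectedComponent (h^[k] x) := by
  induction k generalizing x with
  | zero => simp
  | succ k ih =>
    rw [Function.iterate_succ, image_comp, h.image_connectedComponent_eq, ih]
    rfl

theorem nontrivial_connectedComponent_iterate {X : Type*} [TopologicalSpace X] (h : X ≃ₜ X)
    (k : ℕ) {x : X} (hx : (connectedComponent x).Nontrivial) :
    (connectedComponent (h^[k] x)).Nontrivial := by
  rw [← h.image_iterate_connectedComponent]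
  exact hx.image (h.injective.iterate k)

/-- A nondegenerate component is not periodic: otherwise the finitely many components in its orbit
would cover the space, while there are degenerate components. -/
theorem IsCantoroid.injective_connectedComponent_iterate {X : Type*} [TopologicalSpace X]
    (hX : IsCantoroid X) {h : X ≃ₜ X} (hm : IsMinimalMap h) {x : X}
    (hx : (connectedComponent x).Nontrivial) :
    Function.Injective fun k : ℕ => connectedComponent (h^[k] x) := by
  refine .of_lt_imp_ne fun i j hij heq => ?_
  obtain ⟨n, rfl⟩ := Nat.exists_eq_add_of_lt hij
  set z := h^[i] x with hz
  have hper : connectedComponent (h^[n + 1] z) = connectedComponent z := by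
    rw [heq, hz, ← Function.iterate_add_apply]
    congr 2
    omega
  have hperk (k : ℕ) : connectedComponent (h^[k + (n + 1)] z) = connectedComponent (h^[k] z) := by
    rw [Function.iterate_add_apply, ← h.image_iterate_connectedComponent, hper,
      h.image_iterate_connectedComponent]
  have hmod (k : ℕ) : ∃ m < n + 1, h^[k] z ∈ connectedComponent (h^[m] z) := by
    induction k using Nat.strong_induction_on with
    | _ k ih =>
      by_cases hk : k < n + 1
      · exact ⟨k, hk, mem_connectedComponent⟩
      · obtain ⟨m, hmn, hmem⟩ := ih (k - (n + 1)) (by omega)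
        refine ⟨m, hmn, ?_⟩
        rw [connectedComponent_eq hmem, ← hperk, Nat.sub_add_cancel (by omega)]
        exact mem_connectedComponent
  have hclosed : IsClosed (⋃ m ∈ Iio (n + 1), connectedComponent (h^[m] z)) :=
    (finite_Iio _).isClosed_biUnion fun m _ => isClosed_connectedComponent
  have huniv : (⋃ m ∈ Iio (n + 1), connectedComponent (h^[m] z)) = univ := by
    rw [← hclosed.closure_eq]
    refine ((hm z).mono ?_).closure_eq
    rintro _ ⟨k, rfl⟩
    obtain ⟨m, hmn, hmem⟩ := hmod k
    exact mem_biUnion (mem_Iio.2 hmn) hmem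
  have := hX.nonempty
  obtain ⟨d, hd⟩ := hX.dense_degenerate.nonempty
  obtain ⟨m, -, hdm⟩ := mem_iUnion₂.1 (huniv ▸ mem_univ d)
  have hnt :=
    nontrivial_connectedComponent_iterate h m (nontrivial_connectedComponent_iterate h i hx)
  rw [connectedComponent_eq hdm, show connectedComponent d = {d} from hd] at hnt
  exact not_nontrivial_singleton hnt

/-- The orbits of two points of a nondegenerate component are asymptotic, since the iterates of the
component are pairwise distinct and the components form a null sequence. -/
theorem IsTameCantoroid.tendsto_uniformity_iterate {X : Type*} [UniformSpace X]
    (hX : IsTameCantoroid X) {h : X ≃ₜ X} (hm : IsMinimalMap h) {x y : X}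
    (hx : (connectedComponent x).Nontrivial) (hy : y ∈ connectedComponent x) :
    Tendsto (fun k : ℕ => (h^[k] x, h^[k] y)) atTop (𝓤 X) := by
  intro V hV
  have hfin := ((hX.null V hV).preimage
    (hX.injective_connectedComponent_iterate hm hx).injOn).eventually_cofinite_notMem
  rw [Nat.cofinite_eq_atTop] at hfin
  refine mem_map.2 ?_
  filter_upwards [hfin] with k hk
  simp only [mem_preimage, mem_ofPred_eq, exists_apply_eq_apply', true_and, not_not] at hk
  refine hk ⟨mem_connectedComponent, ?_⟩
  rw [← h.image_iterate_connectedComponent]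
  exact mem_image_of_mem _ hy

/-- If a semiconjugacy maps `x` into the nondegenerate component of `y`, then the orbit of `y`
converges along every subsequence along which the orbit of `x` does: it is asymptotic to the image
of the orbit of `x`. -/
theorem IsTameCantoroid.convergesAlong_of_semiconj {X Y : Type*} [TopologicalSpace X]
    [UniformSpace Y] (hY : IsTameCantoroid Y) {h : X ≃ₜ X} {g : Y ≃ₜ Y} (gm : IsMinimalMap g)
    {φ : X → Y} (hφ : Continuous φ) (hc : Function.Semiconj φ h g) {x : X} {y : Y}
    (hy : (connectedComponent y).Nontrivial) (hxy : φ x ∈ connectedComponent y) :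
    ConvergesAlong (fun k => h^[k] x) fun k => g^[k] y := by
  rintro n hn ⟨l, hl⟩
  have h₁ : Tendsto (fun k => g^[n k] (φ x)) atTop (𝓝 (φ l)) := by
    refine ((hφ.tendsto l).comp hl).congr fun k => ?_
    exact hc.iterate_right (n k) x
  exact ⟨φ l, h₁.congr_uniformity
    ((hY.tendsto_uniformity_iterate gm hy hxy).uniformity_symm.comp hn.tendsto_atTop)⟩

theorem exists_tendsto_coe_iff {X : Type*} [TopologicalSpace X] {s : Set X} (hs : IsClosed s)
    {a : ℕ → s} : (∃ l, Tendsto (fun k => (a k : X)) atTop (𝓝 l)) ↔ ∃ l, Tendsto a atTop (𝓝 l) := by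
  constructor
  · rintro ⟨l, hl⟩
    exact ⟨⟨l, hs.mem_of_tendsto hl (Eventually.of_forall fun k => (a k).2)⟩,
      tendsto_subtype_rng.2 hl⟩
  · rintro ⟨l, hl⟩
    exact ⟨l, tendsto_subtype_rng.1 hl⟩

theorem convergesAlong_coe_iff {X Y : Type*} [TopologicalSpace X] [TopologicalSpace Y] {s : Set X}
    {t : Set Y} (hs : IsClosed s) (ht : IsClosed t) {a : ℕ → s} {b : ℕ → t} :
    ConvergesAlong (fun k => (a k : X)) (fun k => (b k : Y)) ↔ ConvergesAlong a b :=
  forall₂_congr fun _ _ => imp_congr (exists_tendsto_coe_iff hs) (exists_tendsto_coe_iff ht)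

/-! ### Borel selection of points in the nondegenerate components -/

section Selection

variable {X : Type*}

/-- The union of the components of `C` which are not `V`-small and meet the closure of `U`. -/
def largeComponentsMeeting [TopologicalSpace X] (V : Set (X × X)) (U : Set X)
    (C : NonemptyCompacts X) : Set X :=
  {x | ∃ y, (y ∈ closure U ∧ InLargeComponent V C y) ∧ x ∈ connectedComponentIn (C : Set X) y}

/-- Exactly one component of `C` which is not `V`-small meets the closure of `U`. -/
def IsolatesComponent [TopologicalSpace X] (V : Set (X × X)) (U : Set X) (C : NonemptyCompacts X) :
    Prop :=
  (∃ x, x ∈ largeComponentsMeeting V U C) ∧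
    ¬ ∃ w : X × X, (w.1 ∈ largeComponentsMeeting V U C ∧ w.2 ∈ largeComponentsMeeting V U C) ∧
      w.2 ∉ connectedComponentIn (C : Set X) w.1

theorem isClosed_setOf_mem_largeComponentsMeeting [TopologicalSpace X] [T2Space X] [CompactSpace X]
    {V : Set (X × X)} (hV : IsOpen V) (U : Set X) :
    IsClosed {z : NonemptyCompacts X × X | z.2 ∈ largeComponentsMeeting V U z.1} := by
  refine isClosed_setOf_exists (A := fun (z : NonemptyCompacts X × X) y =>
    (y ∈ closure U ∧ InLargeComponent V z.1 y) ∧ z.2 ∈ connectedComponentIn (z.1 : Set X) y) ?_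
  refine ((isClosed_closure.preimage continuous_snd).inter ?_).inter ?_
  · exact (isClosed_setOf_inLargeComponent hV).preimage
      (f := fun z : (NonemptyCompacts X × X) × X => (z.1.1, z.2)) (by fun_prop)
  · exact isClosed_setOf_mem_connectedComponentIn.preimage
      (f := fun z : (NonemptyCompacts X × X) × X => (z.1.1, z.2, z.1.2)) (by fun_prop)

theorem measurableSet_isolatesComponent [TopologicalSpace X] [T2Space X] [CompactSpace X]
    [SecondCountableTopology X] {V : Set (X × X)} (hV : IsOpen V) (U : Set X) :
    MeasurableSet {C : NonemptyCompacts X | IsolatesComponent V U C} := by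
  have hc := isClosed_setOf_mem_largeComponentsMeeting hV U
  refine (isClosed_setOf_exists (A := fun (C : NonemptyCompacts X) x =>
    x ∈ largeComponentsMeeting V U C) hc).measurableSet.inter (MeasurableSet.compl ?_)
  exact measurableSet_setOf_exists
    (A := fun (C : NonemptyCompacts X) (w : X × X) =>
      w.1 ∈ largeComponentsMeeting V U C ∧ w.2 ∈ largeComponentsMeeting V U C)
    (B := fun C w => w.2 ∉ connectedComponentIn (C : Set X) w.1)
    ((hc.preimage (f := fun z : NonemptyCompacts X × X × X => (z.1, z.2.1)) (by fun_prop)).inter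
      (hc.preimage (f := fun z : NonemptyCompacts X × X × X => (z.1, z.2.2)) (by fun_prop)))
    isClosed_setOf_mem_connectedComponentIn.isOpen_compl

theorem IsolatesComponent.eq_connectedComponentIn [TopologicalSpace X] {V : Set (X × X)} {U : Set X}
    {C : NonemptyCompacts X} (h : IsolatesComponent V U C) {x : X}
    (hx : x ∈ largeComponentsMeeting V U C) :
    largeComponentsMeeting V U C = connectedComponentIn (C : Set X) x := by
  refine Subset.antisymm (fun z hz => ?_) fun z hz => ?_
  · by_contra hcon
    exact h.2 ⟨(x, z), ⟨hx, hz⟩, hcon⟩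
  · obtain ⟨y, hy, hyx⟩ := hx
    exact ⟨y, hy, connectedComponentIn_congr hyx ▸ hz⟩

/-- In a null family of components, each nondegenerate component is isolated by some entourage and
some basic open set. -/
theorem exists_isolatesComponent [UniformSpace X] [T2Space X] [CompactSpace X]
    {V : ℕ → Set (X × X)} (hV : (𝓤 X).HasBasis (fun _ => True) V) {B : Set (Set X)}
    (hB : IsTopologicalBasis B) {C : NonemptyCompacts X}
    (hnull : ∀ W ∈ 𝓤 {x // x ∈ C},
      {K : Set {x // x ∈ C} | (∃ x, K = connectedComponent x) ∧ ¬ K ×ˢ K ⊆ W}.Finite)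
    {y : {x // x ∈ C}} (hy : (connectedComponent y).Nontrivial) :
    ∃ n, ∃ U ∈ B, IsolatesComponent (V n) U C ∧ (y : X) ∈ largeComponentsMeeting (V n) U C := by
  have : CompactSpace {x // x ∈ C} := isCompact_iff_compactSpace.1 C.isCompact
  obtain ⟨z, hz, hne⟩ := hy.exists_ne y
  obtain ⟨n, hn⟩ : ∃ n, ((y : X), (z : X)) ∉ V n := by
    by_contra! h
    exact hne (Subtype.ext (eq_of_uniformity_basis hV fun {n} _ => h n).symm)
  have hlarge : InLargeComponent (V n) C y :=
    ⟨(y, z), coe_mem_connectedComponentIn_iff.2 mem_connectedComponent,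
      coe_mem_connectedComponentIn_iff.2 hz, hn⟩
  have hfin := (null_iff hV C).1 hnull n
  set S := {K : Set {x // x ∈ C} | (∃ x, K = connectedComponent x) ∧
      ¬ K ×ˢ K ⊆ Prod.map Subtype.val Subtype.val ⁻¹' V n}
  -- By the null condition, the union of the remaining large components is closed.
  let T : Set X := ⋃ K ∈ S \ {connectedComponent y}, Subtype.val '' K
  have hT : IsClosed T := by
    refine hfin.sdiff.isClosed_biUnion fun K hK => ?_
    obtain ⟨x, rfl⟩ := hK.1.1
    exact (isClosed_connectedComponent.isCompact.image continuous_subtype_val).isClosed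
  have hyT : (y : X) ∉ T := by
    intro h
    obtain ⟨K, hK, w, hw, hwy⟩ := mem_iUnion₂.1 h
    obtain rfl := Subtype.ext hwy
    obtain ⟨x, rfl⟩ := hK.1.1
    exact hK.2 (connectedComponent_eq hw)
  obtain ⟨U, hU, hyU, hUT⟩ := hB.exists_closure_subset (hT.isOpen_compl.mem_nhds hyT)
  have hmem {x : X} (hx : x ∈ largeComponentsMeeting (V n) U C) :
      x ∈ connectedComponentIn (C : Set X) y := by
    obtain ⟨w, ⟨hwU, hw⟩, hxw⟩ := hx
    have hwy : connectedComponent (⟨w, hw.mem⟩ : {x // x ∈ C}) = connectedComponent y := by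
      by_contra hne
      refine hUT hwU (mem_biUnion (x := connectedComponent (⟨w, hw.mem⟩ : {x // x ∈ C}))
        ⟨⟨⟨_, rfl⟩, ?_⟩, hne⟩ ⟨⟨w, hw.mem⟩, mem_connectedComponent, rfl⟩)
      exact (inLargeComponent_coe_iff (x := ⟨w, hw.mem⟩)).1 hw
    have hyw : (y : X) ∈ connectedComponentIn (C : Set X) w :=
      (coe_mem_connectedComponentIn_iff (x := ⟨w, hw.mem⟩)).2 (hwy ▸ mem_connectedComponent)
    rwa [connectedComponentIn_congr hyw]
  have hyM : (y : X) ∈ largeComponentsMeeting (V n) U C :=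
    ⟨y, ⟨subset_closure hyU, hlarge⟩, coe_mem_connectedComponentIn_iff.2 mem_connectedComponent⟩
  refine ⟨n, U, hU, ⟨⟨y, hyM⟩, ?_⟩, hyM⟩
  rintro ⟨w, ⟨h₁, h₂⟩, h₃⟩
  refine h₃ ?_
  rw [connectedComponentIn_congr (hmem h₁)]
  exact hmem h₂

theorem nontrivial_of_mem_largeComponentsMeeting [UniformSpace X] {V : Set (X × X)} (hV : V ∈ 𝓤 X)
    {U : Set X} {C : NonemptyCompacts X} {x : {x // x ∈ C}}
    (hx : (x : X) ∈ largeComponentsMeeting V U C) : (connectedComponent x).Nontrivial := by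
  obtain ⟨y, ⟨-, hy⟩, hxy⟩ := hx
  have := inLargeComponent_coe_iff.1 (hy.congr hxy)
  by_contra hs
  rw [not_nontrivial_iff] at hs
  refine this fun w hw => ?_
  have : w.1 = w.2 := hs hw.1 hw.2
  change ((w.1 : X), (w.2 : X)) ∈ V
  rw [this]
  exact refl_mem_uniformity hV

/-- For a Borel family of compact sets `c s` with a null sequence of nondegenerate components, of
which there is at least one, there are Borel functions which select exactly one point in every
nondegenerate component and no other points. -/
theorem exists_measurable_selection [UniformSpace X] [T2Space X] [CompactSpace X]
    [SecondCountableTopology X] [(𝓤 X).IsCountablyGenerated] [MeasurableSpace X] [BorelSpace X]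
    {Z : Type*} [MeasurableSpace Z] {c : Z → NonemptyCompacts X} (hc : Measurable c)
    (hnull : ∀ s, ∀ W ∈ 𝓤 {x // x ∈ c s},
      {K : Set {x // x ∈ c s} | (∃ x, K = connectedComponent x) ∧ ¬ K ×ˢ K ⊆ W}.Finite)
    (hnt : ∀ s, ∃ x : {x // x ∈ c s}, (connectedComponent x).Nontrivial) :
    ∃ x : ℕ → (s : Z) → {x // x ∈ c s}, (∀ n, Measurable fun s => (x n s : X)) ∧
      (∀ n s, (connectedComponent (x n s)).Nontrivial) ∧
      ∀ s, ∀ y : {x // x ∈ c s}, (connectedComponent y).Nontrivial →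
        ∃! z, z ∈ range (fun n => x n s) ∧ z ∈ connectedComponent y := by
  classical
  obtain hZ | ⟨⟨s₀⟩⟩ := isEmpty_or_nonempty Z
  · exact ⟨fun _ s => isEmptyElim s, fun _ => measurable_of_empty _, fun _ s => isEmptyElim s,
      fun s => isEmptyElim s⟩
  have : Nonempty X := ⟨(hnt s₀).choose⟩
  obtain ⟨V, hV, hVo⟩ := exists_basis_isOpen_uniformity (X := X)
  have hB := isBasis_countableBasis X
  have hex (s : Z) (y : {x // x ∈ c s}) (hy : (connectedComponent y).Nontrivial) :
      ∃ i : ℕ × countableBasis X, IsolatesComponent (V i.1) i.2 (c s) ∧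
        (y : X) ∈ largeComponentsMeeting (V i.1) i.2 (c s) := by
    obtain ⟨n, U, hU, h⟩ := exists_isolatesComponent hV hB (hnull s) hy
    exact ⟨(n, ⟨U, hU⟩), h⟩
  have : Nonempty (ℕ × countableBasis X) := ⟨(hex s₀ _ (hnt s₀).choose_spec).choose⟩
  have : Countable (countableBasis X) := countable_countableBasis X
  obtain ⟨e, he⟩ := exists_surjective_nat (ℕ × countableBasis X)
  let M (j : ℕ) (C : NonemptyCompacts X) : Set X := largeComponentsMeeting (V (e j).1) (e j).2 C
  let P (j : ℕ) (s : Z) : Prop := IsolatesComponent (V (e j).1) (e j).2 (c s)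
  have hMc (j : ℕ) : IsClosed {z : NonemptyCompacts X × X | z.2 ∈ M j z.1} :=
    isClosed_setOf_mem_largeComponentsMeeting (hVo _) _
  have hP (s : Z) : ∃ j, P j s := by
    obtain ⟨y, hy⟩ := hnt s
    obtain ⟨i, hi, -⟩ := hex s y hy
    obtain ⟨j, rfl⟩ := he i
    exact ⟨j, hi⟩
  have hPm (j : ℕ) : MeasurableSet {s | P j s} :=
    (measurableSet_isolatesComponent (hVo _) _).preimage hc
  have hgm (j : ℕ) : Measurable fun s => leastPoint (M j (c s)) :=
    (measurable_leastPoint (A := fun C x => x ∈ M j C) (hMc j)).comp hc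
  -- Where `j` does not isolate a component, the first index which isolates one is used instead.
  let J (j : ℕ) (s : Z) : ℕ := if P j s then j else Nat.find (hP s)
  have hJ (j : ℕ) (s : Z) : P (J j s) s := by
    by_cases h : P j s
    · simp [J, h]
    · simpa [J, h] using Nat.find_spec (hP s)
  have hleast (j : ℕ) (s : Z) (h : P j s) : leastPoint (M j (c s)) ∈ M j (c s) :=
    leastPoint_mem ((hMc j).preimage (Continuous.prodMk_right (c s))) h.1
  have hMsub (j : ℕ) (s : Z) {x : X} (hx : x ∈ M j (c s)) : x ∈ c s :=
    let ⟨_, _, h⟩ := hx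
    (mem_of_mem_connectedComponentIn h).2
  let x (n : ℕ) (s : Z) : {x // x ∈ c s} :=
    ⟨leastPoint (M (J n s) (c s)), hMsub _ _ (hleast _ _ (hJ n s))⟩
  refine ⟨x, fun n => ?_, fun n s => ?_, fun s y hy => ?_⟩
  · have : (fun s => (x n s : X)) = fun s => if P n s then leastPoint (M n (c s)) else
        leastPoint (M (Nat.find (hP s)) (c s)) := by
      funext s
      by_cases h : P n s <;> simp [x, J, h]
    rw [this]
    exact Measurable.ite (hPm n) (hgm n) (Measurable.find hgm hPm hP)
  · exact nontrivial_of_mem_largeComponentsMeeting (hV.mem_of_mem trivial)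
      (hleast _ _ (hJ n s))
  · obtain ⟨i, hi, hiy⟩ := hex s y hy
    obtain ⟨j, rfl⟩ := he i
    have hMj : M j (c s) = connectedComponentIn (c s : Set X) y := hi.eq_connectedComponentIn hiy
    have hxj : (x j s : X) = leastPoint (M j (c s)) := by
      simp only [x, J, if_pos (show P j s from hi)]
    refine ⟨x j s, ⟨⟨j, rfl⟩, ?_⟩, ?_⟩
    · rw [← coe_mem_connectedComponentIn_iff, ← hMj, hxj]
      exact hleast j s hi
    · rintro _ ⟨⟨n, rfl⟩, hn⟩
      have h₁ := (hJ n s).eq_connectedComponentIn (hleast _ _ (hJ n s))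
      have h₂ := connectedComponentIn_congr (coe_mem_connectedComponentIn_iff.2 hn)
      refine Subtype.ext ?_
      rw [hxj, hMj, ← h₂]
      exact congrArg leastPoint h₁

end Selection

/-! ### The reduction -/

/-- The value of the coded homeomorphism at a point depends in a Borel way on the code and the
point, since the code contains the graph of the homeomorphism. -/
theorem SystemCode.measurable_apply {Z : Type*} [MeasurableSpace Z] {p : Z → SystemCode}
    (hp : Measurable p) {h : ∀ s, (p s).space ≃ₜ (p s).space} (H : ∀ s, (p s).Codes (h s))
    {x : ∀ s, (p s).space} (hx : Measurable fun s => (x s : HilbertCube)) :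
    Measurable fun s => (h s (x s) : HilbertCube) := by
  refine measurable_of_isClosed fun A hA => ?_
  have hc : IsClosed {z : SystemCode × HilbertCube | ∃ y, (z.2, y) ∈ z.1.2 ∧ y ∈ A} := by
    refine isClosed_setOf_exists (A := fun (z : SystemCode × HilbertCube) y =>
      (z.2, y) ∈ z.1.2 ∧ y ∈ A) (IsClosed.inter ?_ (hA.preimage continuous_snd))
    exact isClosed_setOf_mem_snd.preimage
      (f := fun z : (SystemCode × HilbertCube) × HilbertCube => (z.1.1, z.1.2, z.2)) (by fun_prop)
  convert (hp.prodMk hx) hc.measurableSet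
  ext s
  constructor
  · exact fun hs => ⟨_, (H s).mem_iff.2 rfl, hs⟩
  · rintro ⟨y, hy, hyA⟩
    have := (H s).mem_iff (y := ⟨y, ((H s).mem_space hy).2⟩) |>.1 hy
    rwa [mem_preimage, this]

/-- `IsTameCantoroid.convergesAlong_of_semiconj` for a conjugacy of coded systems, with the orbits
read in the Hilbert cube. -/
theorem SystemCode.convergesAlong_iterate {p q : SystemCode} (hq : IsTameCantoroid q.space)
    {h : p.space ≃ₜ p.space} {g : q.space ≃ₜ q.space} (gm : IsMinimalMap g) {φ : p.space ≃ₜ q.space}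
    (hφ : ∀ x, φ (h x) = g (φ x)) {x : p.space} {y : q.space}
    (hy : (connectedComponent y).Nontrivial) (hxy : φ x ∈ connectedComponent y) :
    ConvergesAlong (fun k => (h^[k] x : HilbertCube)) fun k => (g^[k] y : HilbertCube) :=
  (convergesAlong_coe_iff p.1.isCompact.isClosed q.1.isCompact.isClosed).2
    (hq.convergesAlong_of_semiconj gm φ.continuous hφ hy hxy)

theorem theorem4p5 :
    MeasurableSet minimalTameSystems ∧
    (∃ f : minimalTameSystems → ℕ → ℕ → HilbertCube,
      IsBorelReduction conjugacySetoid (plusSetoid (ettSetoid HilbertCube)) f ∧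
      ∀ (S : minimalTameSystems) (h : S.1.space ≃ₜ S.1.space), S.1.Codes h →
        ∃ x : ℕ → S.1.space,
          (∀ n k, f S n k = (h^[k] (x n) : S.1.space)) ∧
          (∀ n, (connectedComponent (x n)).Nontrivial) ∧
          ∀ y : S.1.space, (connectedComponent y).Nontrivial →
            ∃! z : S.1.space, z ∈ Set.range x ∧ z ∈ connectedComponent y) ∧
    MeasurableSet {p : minimalTameSystems × minimalTameSystems | conjugacySetoid.r p.1 p.2} := by
  have ht (S : minimalTameSystems) : IsTameCantoroid S.1.space := S.2.1
  choose h hh hm using fun S : minimalTameSystems => S.2.2.2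
  obtain ⟨x, hx, hxn, hxu⟩ := exists_measurable_selection (Z := minimalTameSystems)
    (c := fun S => S.1.1) (measurable_fst.comp measurable_subtype_coe) (fun S => (ht S).null)
    fun S => by
      have := S.2.2.1
      rwa [isCantorSpace_iff (ht S).noIsolated, not_not] at this
  let f (S : minimalTameSystems) (n k : ℕ) : HilbertCube := ((h S)^[k] (x n S) : S.1.space)
  have hfm (n k : ℕ) : Measurable fun S => f S n k := by
    induction k with
    | zero => exact hx n
    | succ k ih =>
      simp only [f, Function.iterate_succ_apply']
      exact SystemCode.measurable_apply measurable_subtype_coe hh ih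
  have hex (S : minimalTameSystems) (y : S.1.space) (hy : (connectedComponent y).Nontrivial) :
      ∃ n, x n S ∈ connectedComponent y := by
    obtain ⟨_, ⟨⟨n, rfl⟩, hn⟩, -⟩ := hxu S y hy
    exact ⟨n, hn⟩
  have hred (S T : minimalTameSystems) :
      conjugacySetoid.r S T ↔ (plusSetoid (ettSetoid HilbertCube)).r (f S) (f T) := by
    constructor
    · rintro ⟨h₁, h₂, H₁, H₂, φ, hφ⟩
      obtain rfl := H₁.unique (hh S)
      obtain rfl := H₂.unique (hh T)
      have hφ' (z : T.1.space) : φ.symm (h T z) = h S (φ.symm z) := by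
        rw [φ.symm_apply_eq, hφ, φ.apply_symm_apply]
      have key (n m : ℕ) (h₁ : φ (x n S) ∈ connectedComponent (x m T))
          (h₂ : φ.symm (x m T) ∈ connectedComponent (x n S)) :
          (ettSetoid HilbertCube).r (f S n) (f T m) :=
        ettSetoid_r_iff.2 ⟨SystemCode.convergesAlong_iterate (ht T) (hm T) hφ (hxn m T) h₁,
          SystemCode.convergesAlong_iterate (ht S) (hm S) hφ' (hxn n S) h₂⟩
      refine ⟨fun n => ?_, fun m => ?_⟩
      · obtain ⟨m, hmem⟩ := hex T (φ (x n S)) (by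
          rw [← φ.image_connectedComponent_eq]
          exact (hxn n S).image φ.injective)
        refine ⟨m, key n m (connectedComponent_eq hmem ▸ mem_connectedComponent) ?_⟩
        rw [← φ.symm_apply_apply (x n S), ← φ.symm.image_connectedComponent_eq]
        exact mem_image_of_mem _ hmem
      · obtain ⟨n, hmem⟩ := hex S (φ.symm (x m T)) (by
          rw [← φ.symm.image_connectedComponent_eq]
          exact (hxn m T).image φ.symm.injective)
        refine ⟨n, key n m ?_ (connectedComponent_eq hmem ▸ mem_connectedComponent)⟩
        rw [← φ.apply_symm_apply (x m T), ← φ.image_connectedComponent_eq]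
        exact mem_image_of_mem _ hmem
    · rintro ⟨H, -⟩
      -- One pair of equivalent orbits suffices.
      obtain ⟨m, hmn⟩ := H 0
      obtain ⟨h₁, h₂⟩ := ettSetoid_r_iff.1 hmn
      have hS := S.1.1.isCompact.isClosed
      have hT := T.1.1.isCompact.isClosed
      obtain ⟨φ, hφ⟩ := (hm S).exists_conjugacy (h S).continuous (h T).continuous (hm T)
        ((convergesAlong_coe_iff hS hT).1 h₁) ((convergesAlong_coe_iff hT hS).1 h₂)
      exact ⟨h S, h T, hh S, hh T, φ, hφ⟩
  refine ⟨measurableSet_minimalTameSystems, ⟨f, ⟨?_, hred⟩, fun S g hg => ?_⟩, ?_⟩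
  · exact measurable_pi_iff.2 fun n => measurable_pi_iff.2 fun k => hfm n k
  · obtain rfl := hg.unique (hh S)
    exact ⟨fun n => x n S, fun _ _ => rfl, fun n => hxn n S, hxu S⟩
  · have hett (n m : ℕ) : MeasurableSet {p : minimalTameSystems × minimalTameSystems |
        (ettSetoid HilbertCube).r (f p.1 n) (f p.2 m)} :=
      measurableSet_ettSetoid (fun k => (hfm n k).comp measurable_fst)
        fun k => (hfm m k).comp measurable_snd
    have : {p : minimalTameSystems × minimalTameSystems | conjugacySetoid.r p.1 p.2} =
        (⋂ n, ⋃ m, {p | (ettSetoid HilbertCube).r (f p.1 n) (f p.2 m)}) ∩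
          ⋂ m, ⋃ n, {p | (ettSetoid HilbertCube).r (f p.1 n) (f p.2 m)} := by
      ext p
      simp only [mem_ofPred_eq, hred, mem_inter_iff, mem_iInter, mem_iUnion]
      rfl
    rw [this]
    exact (MeasurableSet.iInter fun n => MeasurableSet.iUnion fun m => hett n m).inter
      (MeasurableSet.iInter fun m => MeasurableSet.iUnion fun n => hett n m)
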